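/- **Setting.** Let $M$ be a von Neumann algebra, $A\subseteq M$ a commutative von Neumann subalgebra (with the same unit), $E=E_A^M:M\to A$ a faithful normal conditional expectation, and $\tau\in M_*$ a faithful tracial state with $\tau\circ E=\tau$. For $v\in M$ write $l(v)=vv^*$, $r(v)=v^*v$; let $A^p$ and $A^{pi}$ be the sets of projections and of partial isometries of $A$. Put $$\mathcal G(M\supseteq A)=\{v\in M : v^*v,\,vv^*\in A^p,\ vAv^*=Avv^*\}.$$ An *$E_A^M$-groupoid* is a subset $\mathcal G\subseteq\mathcal G(M\supseteq A)$ such that: $\mathcal G$ is closed under products and adjoints; $A^{pi}\subseteq\mathcal G$; if $(u_k)$ is a family in $\mathcal G$ whose projections $r(u_k)$ are mutually orthogonal and whose projections $l(u_k)$ are mutually orthogonal, then $\sum_k u_k\in\mathcal G$ ($\sigma$-strong* convergence); for each $u\in\mathcal G$ there is $e\in A^p$ with $e\le l(u)$ and $E(u)=eu$; and $E(uxu^*)=uE(x)u^*$ for all $u\in\mathcal G$, $x\in M$. A *graphing* of $\mathcal G$ is an at most countable family $\mathcal U$ of elements of $\mathcal G$ with $\mathcal G''=(A\cup\mathcal U\cup\mathcal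 U^*)''$. A *treeing* is a family $\mathcal U$ such that $E(w)=0$ for every nonempty word $w$ in $\mathcal U\sqcup\mathcal U^*$ that is formally reduced (no letter is adjacent to its formal inverse, where $u^{-1}=u^*$). $\mathcal G$ is *treeable* if it has a graphing that is a treeing. The cost is $$C_\tau(\mathcal U)=\sum_{u\in\mathcal U}\frac{\tau(l(u)+r(u))}{2},\qquad C_\tau(\mathcal G)=\inf\{C_\tau(\mathcal U):\mathcal U\text{ a graphing of }\mathcal G\}\in[0,\infty].$$ For $p\in A^p$, put $p\mathcal Gp=\{pup:u\in\mathcal G\}$. It is regarded as a groupoid for the inclusion $Ap\subseteq pMp$ of von Neumann algebras with unit $p$ (acting on the range of $p$) and the conditional expectation $E|_{pMp}:pMp\to Ap$. Its graphings, treeings and treeability are defined as above with $Ap$, $E|_{pMp}$ in place of $A$, $E$, and $C_{\tau|_{pMp}}$ is given by the same formulas with the (unnormalized) positive functional $\tau|_{pMp}$. **Proposition.** Let $\mathcal G$ be an $E_A^M$-groupoid with $\mathcal G''=M$, and let $p\in A^p$ have central support $c_M(p)=1$ (i.e. $1$ is the only central projection $z$ of $M$ with $p\le z$). Then 1. $\mathcal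 G$ is treeable if and only if $p\mathcal Gp$ is treeable; 2. $C_\tau(\mathcal G)-1=C_{\tau|_{pMp}}(p\mathcal Gp)-\tau(p)$, as an identity in $(-\infty,+\infty]$. -/

import Mathlib

open scoped BigOperators ENNReal

namespace VNGroupoid

variable {H : Type*} [NormedAddCommGroup H] [InnerProductSpace ℂ H] [CompleteSpace H]

/-- The elements of the von Neumann algebra `M`, as a type: a unital `*`-algebra over `ℂ`. -/
abbrev Elt (M : VonNeumannAlgebra H) : Type _ := M.toStarSubalgebra

/-- `φ` belongs to the predual `M_*`: it is `σ`-weakly continuous, that is, of the form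
`x ↦ ∑ ⟨ξ_n, x η_n⟩` for square-summable sequences of vectors. -/
def IsNormalFunctional {M : VonNeumannAlgebra H} (φ : Elt M →ₗ[ℂ] ℂ) : Prop :=
  ∃ ξ η : ℕ → H, Summable (fun n => ‖ξ n‖ ^ 2) ∧ Summable (fun n => ‖η n‖ ^ 2) ∧
    ∀ x : Elt M, φ x = ∑' n, inner ℂ (ξ n) ((x : H →L[ℂ] H) (η n))

/-- `τ` is a faithful tracial state in `M_*`. -/
structure IsFaithfulTracialState {M : VonNeumannAlgebra H} (τ : Elt M →ₗ[ℂ] ℂ) : Prop where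
  normal : IsNormalFunctional τ
  nonneg_re : ∀ x : Elt M, 0 ≤ (τ (star x * x)).re
  im_eq_zero : ∀ x : Elt M, (τ (star x * x)).im = 0
  map_one : τ 1 = 1
  faithful : ∀ x : Elt M, τ (star x * x) = 0 → x = 0
  tracial : ∀ x y : Elt M, τ (x * y) = τ (y * x)

/-- `E` is a faithful normal conditional expectation of `M` onto its von Neumann subalgebra `A`
(its values are regarded as elements of `M`). -/
structure IsCondExp (M A : VonNeumannAlgebra H) (E : Elt M →ₗ[ℂ] Elt M) : Prop where
  map_mem : ∀ x : Elt M, (E x : H →L[ℂ] H) ∈ A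
  map_eq_self : ∀ a : Elt M, (a : H →L[ℂ] H) ∈ A → E a = a
  bimodule : ∀ a x b : Elt M, (a : H →L[ℂ] H) ∈ A → (b : H →L[ℂ] H) ∈ A →
    E (a * x * b) = a * E x * b
  nonneg : ∀ x : Elt M, 0 ≤ (E (star x * x) : H →L[ℂ] H)
  faithful : ∀ x : Elt M, E (star x * x) = 0 → x = 0
  normal : ∀ φ : Elt M →ₗ[ℂ] ℂ, IsNormalFunctional φ → IsNormalFunctional (φ ∘ₗ E)

/-- The left support projection `l(v) = v v*` of a partial isometry. -/
noncomputable def lsupp {M : VonNeumannAlgebra H} (v : Elt M) : Elt M := v * star v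

/-- The right support projection `r(v) = v* v` of a partial isometry. -/
noncomputable def rsupp {M : VonNeumannAlgebra H} (v : Elt M) : Elt M := star v * v

/-- The von Neumann subalgebra `A ⊆ M`, as a set of elements of `M`. -/
def subalg (M A : VonNeumannAlgebra H) : Set (Elt M) := {a | (a : H →L[ℂ] H) ∈ A}

/-- `A^p`: the projections of `A ⊆ M`. -/
def projections (M A : VonNeumannAlgebra H) : Set (Elt M) :=
  {e | e ∈ subalg M A ∧ IsStarProjection e}

/-- `A^{pi}`: the partial isometries of `A ⊆ M`. -/
def partialIsometries (M A : VonNeumannAlgebra H) : Set (Elt M) :=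
  {a | a ∈ subalg M A ∧ IsStarProjection (star a * a)}

/-- The full normalizing groupoid `{v ∈ M : v*v, vv* ∈ A^p, v A v* = A vv*}` of `A` in `M`. -/
def fullGroupoid (M A : VonNeumannAlgebra H) : Set (Elt M) :=
  {v | rsupp v ∈ projections M A ∧ lsupp v ∈ projections M A ∧
    (fun a => v * a * star v) '' subalg M A = (fun a => a * lsupp v) '' subalg M A}

/-- `G` is an `E`-groupoid, where `E : M → A` is a conditional expectation.

In `sum_mem`, the partial sums are partial isometries, so they are bounded in norm and their
`σ`-strong* convergence is the same as pointwise convergence on vectors of the sums and of their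
adjoints. -/
structure IsGroupoid (M A : VonNeumannAlgebra H) (E : Elt M →ₗ[ℂ] Elt M)
    (G : Set (Elt M)) : Prop where
  subset_full : G ⊆ fullGroupoid M A
  mul_mem : ∀ u ∈ G, ∀ v ∈ G, u * v ∈ G
  star_mem : ∀ u ∈ G, star u ∈ G
  partialIsometry_mem : partialIsometries M A ⊆ G
  sum_mem : ∀ (ι : Type) (u : ι → Elt M) (s : Elt M), (∀ k, u k ∈ G) →
    (∀ j k, j ≠ k → rsupp (u j) * rsupp (u k) = 0) →
    (∀ j k, j ≠ k → lsupp (u j) * lsupp (u k) = 0) →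
    (∀ ξ : H, HasSum (fun k => (u k : H →L[ℂ] H) ξ) ((s : H →L[ℂ] H) ξ)) →
    (∀ ξ : H, HasSum (fun k => ((star (u k) : Elt M) : H →L[ℂ] H) ξ)
      (((star s : Elt M) : H →L[ℂ] H) ξ)) →
    s ∈ G
  expect_eq : ∀ u ∈ G, ∃ e ∈ projections M A, e * lsupp u = e ∧ E u = e * u
  expect_conj : ∀ u ∈ G, ∀ x : Elt M, E (u * x * star u) = u * E x * star u

/-- The von Neumann algebra with unit `e` generated by a set `S` of elements of `eMe`.

A von Neumann algebra on the Hilbert space `eH` is identified with the algebra of operators `x` on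
`H` with `ex = x = xe`. An operator commutes with `e` and `S` if and only if it is the direct sum of
an operator on `eH` commuting with `S` and of any operator on `(1 - e)H`; hence the operators
`x = exe` in the bicommutant on `H` of `S ∪ S* ∪ {e}` form the bicommutant of `S ∪ S*` on `eH`.
For `e = 1` this is the bicommutant of `S ∪ S*` on `H`. -/
def generated {M : VonNeumannAlgebra H} (e : Elt M) (S : Set (Elt M)) : Set (H →L[ℂ] H) :=
  {x | (e : H →L[ℂ] H) * x = x ∧ x * (e : H →L[ℂ] H) = x ∧
    x ∈ Set.centralizer (Set.centralizer
      ((fun y : Elt M => (y : H →L[ℂ] H)) '' (S ∪ star S ∪ {e})))}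

/-- `c` is the central support projection of the projection `p` in `M`: the smallest projection of
the center of `M` that majorizes `p`. -/
def IsCentralSupport {M : VonNeumannAlgebra H} (p c : Elt M) : Prop :=
  (IsStarProjection c ∧ (∀ x : Elt M, c * x = x * c) ∧ p * c = p) ∧
    ∀ z : Elt M, IsStarProjection z → (∀ x : Elt M, z * x = x * z) → p * z = p → c * z = c

/-- The product in `M` of a word in the letters `u i` (coded `(i, true)`) and `(u i)*`
(coded `(i, false)`). -/
noncomputable def wordVal {M : VonNeumannAlgebra H} {ι : Type} (u : ι → Elt M) (w : List (ι × Bool)) : Elt M :=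
  (w.map fun l => if l.2 then u l.1 else star (u l.1)).prod

/-- The family `u` is a treeing with respect to `E`: the expectation of every nonempty word in the
letters `u i`, `(u i)*` that is reduced in the formal sense (no letter stands next to its formal
inverse) vanishes. -/
def IsTreeing {M : VonNeumannAlgebra H} (E : Elt M →ₗ[ℂ] Elt M) {ι : Type} (u : ι → Elt M) : Prop :=
  ∀ w : List (ι × Bool), w ≠ [] → FreeGroup.IsReduced w → E (wordVal u w) = 0

/-- The family `u` is a graphing of `G`, where `G` is a groupoid over the commutative von Neumann
algebra `B` with unit `e`: its members lie in `G`, and `B` and `u` generate the same von Neumann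
algebra (with unit `e`) as `G`. -/
def IsGraphing {M : VonNeumannAlgebra H} (e : Elt M) (B G : Set (Elt M)) {ι : Type}
    (u : ι → Elt M) : Prop :=
  (∀ i, u i ∈ G) ∧ generated e G = generated e (B ∪ Set.range u)

/-- `G`, a groupoid over the commutative von Neumann algebra `B` with unit `e`, is treeable: it has
a countable graphing that is a treeing. -/
def IsTreeable {M : VonNeumannAlgebra H} (E : Elt M →ₗ[ℂ] Elt M) (e : Elt M)
    (B G : Set (Elt M)) : Prop :=
  ∃ (ι : Type) (_ : Countable ι) (u : ι → Elt M), IsGraphing e B G u ∧ IsTreeing E u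

/-- The `τ`-cost `∑ τ(l(u i) + r(u i)) / 2` of a family, in `[0, ∞]`. -/
noncomputable def familyCost {M : VonNeumannAlgebra H} (τ : Elt M →ₗ[ℂ] ℂ) {ι : Type}
    (u : ι → Elt M) : ℝ≥0∞ :=
  ∑' i, ENNReal.ofReal ((τ (lsupp (u i) + rsupp (u i))).re / 2)

/-- The `τ`-cost of `G`, a groupoid over the commutative von Neumann algebra `B` with unit `e`: the
infimum of the costs of its countable graphings, in `[0, ∞]`. -/
noncomputable def cost {M : VonNeumannAlgebra H} (τ : Elt M →ₗ[ℂ] ℂ) (e : Elt M)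
    (B G : Set (Elt M)) : ℝ≥0∞ :=
  sInf {c | ∃ (ι : Type) (_ : Countable ι) (u : ι → Elt M),
    IsGraphing e B G u ∧ c = familyCost τ u}

/-- `pSp = {p s p : s ∈ S}`. For `S = A` commutative and `p ∈ A` this is `Ap`. -/
def corner {M : VonNeumannAlgebra H} (p : Elt M) (S : Set (Elt M)) : Set (Elt M) :=
  (fun s => p * s * p) '' S

end VNGroupoid

/-! ### Algebra of partial isometries normalizing a commutative subring. -/

namespace VNGroupoid

/-! The argument is the groupoid version of contracting a maximal tree in a graph. A decomposition
of `1` into orthogonal projections `f n` of `A` with `f 0 = p` plays the role of a vertex set, and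
elements `t n` of `G`, each carrying a subprojection of an earlier `f (par n)` onto `f (n + 1)`, are
the edges. Since the trace gives equal mass to `l` and `r`, such a tree has cost `∑ τ (f (n + 1)) =
1 - τ p`, whatever its shape. That `f` exhausts `1` comes from central support: the sum `Q` of the
`f n` commutes with generators of `M` and majorizes `p` (`IsTree.eq_one_of_invariant`).

From the corner to `G`, a tree of height one (`exists_complete_star`), chosen greedily by trace, is
added to a graphing of the corner. It generates because every block `f a * y * f b` is a corner
element moved along tree paths. Freeness survives because a nonzero reduced word can use tree edges
only at its two ends; its expectation then vanishes for off-diagonal reasons or by `E (u x u*) = u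
E(x) u*`.

From `G` to the corner, the tree must be cut out of the given graphing `u` (`exists_complete_tree`).
Each `u i` is divided into pieces `f a * u i * f b`, which does not change the total cost; the
pieces used as tree edges are discarded, and the others are transported to `p` along tree paths `w`,
which does not change their trace. Generation is checked on commutants, by amplifying an operator
`T` on the corner to `∑ w n T (w n)*` (`IsTree.commute_corner`). Freeness is a statement about free
groups: killing the tree edges is a left inverse of the map sending a remaining edge to its loop
through the root (`IsTreeing.compress`).

Both passages change the cost by exactly `1 - τ p` and preserve treeings, so treeability transfers
and the infima differ by this number. -/

/-- Algebraic properties of a set `G` of partial isometries of a `*`-ring normalizing a commutative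
unital `*`-subring `A`. -/
structure IsNormalizing {R : Type*} [Ring R] [StarRing R] (A G : Set R) : Prop where
  comm : ∀ a ∈ A, ∀ b ∈ A, a * b = b * a
  one_mem : 1 ∈ A
  mul_mem : ∀ a ∈ A, ∀ b ∈ A, a * b ∈ A
  sub_mem : ∀ a ∈ A, ∀ b ∈ A, a - b ∈ A
  star_mem : ∀ a ∈ A, star a ∈ A
  isom : ∀ u ∈ G, u * star u * u = u
  g_mul : ∀ u ∈ G, ∀ v ∈ G, u * v ∈ G
  g_star : ∀ u ∈ G, star u ∈ G
  conj_mem : ∀ u ∈ G, ∀ a ∈ A, u * a * star u ∈ A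
  proj_mem : ∀ a ∈ A, IsStarProjection a → a ∈ G

namespace IsNormalizing

variable {R : Type*} [Ring R] [StarRing R] {A G : Set R}

theorem add_mem (h : IsNormalizing A G) {a b : R} (ha : a ∈ A) (hb : b ∈ A) : a + b ∈ A := by
  have h0 : (0 : R) ∈ A := by simpa using h.sub_mem a ha a ha
  simpa using h.sub_mem a ha _ (h.sub_mem 0 h0 b hb)

theorem zero_mem (h : IsNormalizing A G) : (0 : R) ∈ A := by simpa using h.sub_mem 1 h.one_mem 1 h.one_mem

theorem sum_mem (h : IsNormalizing A G) {ι : Type*} (s : Finset ι) (f : ι → R) (hf : ∀ i, f i ∈ A) :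
    ∑ i ∈ s, f i ∈ A := by
  classical
  induction s using Finset.induction_on with
  | empty => simpa using h.zero_mem
  | insert i s hi ih => rw [Finset.sum_insert hi]; exact h.add_mem (hf i) ih

theorem g_one (h : IsNormalizing A G) : (1 : R) ∈ G := h.proj_mem 1 h.one_mem (.one R)

theorem lsupp_mem (h : IsNormalizing A G) {u : R} (hu : u ∈ G) : u * star u ∈ A := by
  simpa using h.conj_mem u hu 1 h.one_mem

theorem rsupp_mem (h : IsNormalizing A G) {u : R} (hu : u ∈ G) : star u * u ∈ A := by
  simpa using h.lsupp_mem (h.g_star u hu)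

/-- Elements of `A` can be moved to the left through elements of `G`. -/
theorem swap (h : IsNormalizing A G) {u a : R} (hu : u ∈ G) (ha : a ∈ A) : u * a = u * a * star u * u := by
  have := h.comm _ ha _ (h.rsupp_mem hu)
  calc u * a = u * star u * u * a := by rw [h.isom u hu]
    _ = u * (star u * u * a) := by simp only [mul_assoc]
    _ = _ := by rw [← this]; simp only [mul_assoc]

theorem conj_proj (h : IsNormalizing A G) {u e : R} (hu : u ∈ G) (he : e ∈ A) (hp : IsStarProjection e) :
    IsStarProjection (u * e * star u) where
  isIdempotentElem := by
    have h1 := h.swap hu he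
    have h2 := hp.isIdempotentElem.eq
    calc u * e * star u * (u * e * star u) = (u * e * star u * u) * e * star u := by
          simp only [mul_assoc]
      _ = u * (e * e) * star u := by rw [← h1]; simp only [mul_assoc]
      _ = _ := by rw [h2]
  isSelfAdjoint := by
    have := hp.isSelfAdjoint.star_eq
    simp [IsSelfAdjoint, mul_assoc, this]

end IsNormalizing

/-! ### Trees of projections and their paths. -/

/-- Recursion in which the value at `n + 1` may depend on all earlier values. -/
theorem exists_sequence_of_step {α : Type*} (a : α) (Φ : ℕ → (ℕ → α) → α)
    (hΦ : ∀ n f g, (∀ k ≤ n, f k = g k) → Φ n f = Φ n g) :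
    ∃ f : ℕ → α, f 0 = a ∧ ∀ n, f (n + 1) = Φ n f := by
  -- `F n` is a whole function, already correct at the arguments up to `n`; only its diagonal is
  -- kept.
  let F : ℕ → ℕ → α := fun n => Nat.rec (fun _ => a) (fun n g => Function.update g (n + 1) (Φ n g)) n
  have hF : ∀ n, F (n + 1) = Function.update (F n) (n + 1) (Φ n (F n)) := fun n => rfl
  have key : ∀ k n, k ≤ n → F n k = F k k := by
    intro k n hkn
    induction n, hkn using Nat.le_induction with
    | base => rfl
    | succ n hn ih => rw [hF, Function.update_of_ne (by omega), ih]
  refine ⟨fun n => F n n, rfl, fun n => ?_⟩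
  simp only [hF n, Function.update_self]
  exact hΦ n _ _ fun k hk => key k n hk

/-- Elements `t n` of `G` connecting the mutually orthogonal projections `f (n + 1)` of `A` to
subprojections of earlier ones, with root `f 0 = p`. -/
structure IsTree {R : Type*} [Ring R] [StarRing R] (A G : Set R) (p : R) (par : ℕ → ℕ)
    (f t : ℕ → R) : Prop where
  par_le : ∀ n, par n ≤ n
  root : f 0 = p
  f_mem : ∀ n, f n ∈ A
  f_proj : ∀ n, IsStarProjection (f n)
  orth : ∀ i j, i ≠ j → f i * f j = 0
  t_mem : ∀ n, t n ∈ G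
  lsupp : ∀ n, t n * star (t n) = f (n + 1)
  mul_par : ∀ n, t n * f (par n) = t n

/-- Trees can be built by greedy choice of connecting elements. -/
theorem IsNormalizing.exists_isTree {R : Type*} [Ring R] [StarRing R] {A G : Set R}
    (h : IsNormalizing A G) {p : R} (hpA : p ∈ A) (hp : IsStarProjection p)
    (X : ℕ → R → R) (hX : ∀ n b, b ∈ A → X n b ∈ G) (par : ℕ → ℕ) (hpar : ∀ n, par n ≤ n) :
    ∃ f x : ℕ → R, (∀ n, x n = X n (∑ k ∈ Finset.range (n + 1), f k)) ∧
      (∀ n, f (n + 1) = x n * f (par n) * star (x n) * (1 - ∑ k ∈ Finset.range (n + 1), f k)) ∧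
      (∀ n, x n ∈ G) ∧
      IsTree A G p par f (fun n => f (n + 1) * x n) := by
  obtain ⟨f, f0, fs⟩ := exists_sequence_of_step p
    (fun n f => X n (∑ k ∈ Finset.range (n + 1), f k) * f (par n) *
      star (X n (∑ k ∈ Finset.range (n + 1), f k)) * (1 - ∑ k ∈ Finset.range (n + 1), f k))
    (by
      intro n f g hfg
      have h1 : ∑ k ∈ Finset.range (n + 1), f k = ∑ k ∈ Finset.range (n + 1), g k :=
        Finset.sum_congr rfl fun k hk => hfg k (by simpa [Nat.lt_succ_iff] using hk)
      simp only [h1, hfg _ (hpar n)])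
  -- Membership and orthogonality are proved together: orthogonality makes the partial sum `B` a
  -- projection, and then `f (n + 1)`, a product of two commuting projections of `A`, is one too.
  have main : ∀ n, (∀ k ≤ n, f k ∈ A ∧ IsStarProjection (f k)) ∧
      (∀ i ≤ n, ∀ j ≤ n, i ≠ j → f i * f j = 0) := by
    intro n
    induction n with
    | zero =>
      refine ⟨fun k hk => ?_, fun i hi j hj => by omega⟩
      obtain rfl : k = 0 := by omega
      rw [f0]; exact ⟨hpA, hp⟩
    | succ n ih =>
      obtain ⟨ih1, ih2⟩ := ih
      set B := ∑ k ∈ Finset.range (n + 1), f k with hB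
      have hfB : ∀ k ≤ n, B * f k = f k := by
        intro k hk
        rw [hB, Finset.sum_mul, Finset.sum_eq_single k]
        · exact (ih1 k hk).2.isIdempotentElem
        · intro j hj hjk
          exact ih2 j (by simpa [Nat.lt_succ_iff] using hj) k hk hjk
        · simp; omega
      have hBA : B ∈ A := by
        have : B = ∑ k ∈ Finset.range (n + 1), if k ≤ n then f k else 0 :=
          Finset.sum_congr rfl fun k hk => by
            rw [if_pos (by simpa [Nat.lt_succ_iff] using hk)]
        rw [this]
        refine h.sum_mem _ _ fun k => ?_
        split_ifs with hk
        · exact (ih1 k hk).1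
        · exact h.zero_mem
      have hBp : IsStarProjection B := by
        constructor
        · rw [IsIdempotentElem]
          conv_lhs => rw [hB, ← hB, Finset.mul_sum]
          exact Finset.sum_congr rfl fun k hk => hfB k (by simpa [Nat.lt_succ_iff] using hk)
        · rw [IsSelfAdjoint, hB, star_sum]
          exact Finset.sum_congr rfl fun k hk =>
            (ih1 k (by simpa [Nat.lt_succ_iff] using hk)).2.isSelfAdjoint
      have h1B := h.sub_mem _ h.one_mem _ hBA
      have hx := hX n B hBA
      obtain ⟨hpA', hpp'⟩ := ih1 _ (hpar n)
      have hc := h.conj_mem _ hx _ hpA'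
      have hn1 : f (n + 1) = _ := fs n
      have hnA : f (n + 1) ∈ A := by rw [hn1]; exact h.mul_mem _ hc _ h1B
      have hnp : IsStarProjection (f (n + 1)) := by
        rw [hn1]
        exact (h.conj_proj hx hpA' hpp').mul hBp.one_sub (h.comm _ hc _ h1B)
      have ho : ∀ k ≤ n, f (n + 1) * f k = 0 := by
        intro k hk
        rw [hn1, mul_assoc, sub_mul, ← hB, hfB k hk]; simp
      refine ⟨fun k hk => ?_, fun i hi j hj hij => ?_⟩
      · rcases Nat.le_succ_iff.1 hk with hk | rfl
        · exact ih1 k hk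
        · exact ⟨hnA, hnp⟩
      · rcases Nat.le_succ_iff.1 hi with hi | rfl <;> rcases Nat.le_succ_iff.1 hj with hj | rfl
        · exact ih2 i hi j hj hij
        · rw [h.comm _ (ih1 i hi).1 _ hnA]; exact ho i hi
        · exact ho j hj
        · exact absurd rfl hij
  have fA : ∀ n, f n ∈ A := fun n => ((main n).1 n le_rfl).1
  have fp : ∀ n, IsStarProjection (f n) := fun n => ((main n).1 n le_rfl).2
  let x : ℕ → R := fun n => X n (∑ k ∈ Finset.range (n + 1), f k)
  have hxG : ∀ n, x n ∈ G := fun n => hX n _ (h.sum_mem _ _ fA)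
  have fs' : ∀ n, f (n + 1) = x n * f (par n) * star (x n) *
    (1 - ∑ k ∈ Finset.range (n + 1), f k) := fs
  -- The new vertex lies under the image of its parent, so cutting `x n` on the left by `f (n + 1)`
  -- already forces its source under `f (par n)`.
  have le : ∀ n, f (n + 1) * (x n * f (par n) * star (x n)) = f (n + 1) := by
    intro n
    have hc := h.conj_mem _ (hxG n) _ (fA (par n))
    rw [h.comm _ (fA _) _ hc, fs' n, ← mul_assoc,
      (h.conj_proj (hxG n) (fA _) (fp _)).isIdempotentElem.eq]
  refine ⟨f, x, fun n => rfl, fs', hxG, hpar, f0, fA, fp, fun i j hij => ?_, fun n => ?_,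
    fun n => ?_, fun n => ?_⟩
  · exact (main (max i j)).2 i (le_max_left _ _) j (le_max_right _ _) hij
  · exact h.g_mul _ (h.proj_mem _ (fA _) (fp _)) _ (hxG n)
  · have h1 : f (n + 1) * (x n * star (x n)) = f (n + 1) := by
      conv_lhs => rw [← le n]
      have : x n * f (par n) * star (x n) * (x n * star (x n)) =
          (x n * f (par n) * star (x n) * x n) * star (x n) := by simp only [mul_assoc]
      rw [mul_assoc, this, ← h.swap (hxG n) (fA _), le]
    rw [star_mul, (fp (n + 1)).isSelfAdjoint.star_eq]
    calc f (n + 1) * x n * (star (x n) * f (n + 1))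
        = f (n + 1) * (x n * star (x n)) * f (n + 1) := by simp only [mul_assoc]
      _ = f (n + 1) := by rw [h1, (fp _).isIdempotentElem.eq]
  · calc f (n + 1) * x n * f (par n) = f (n + 1) * (x n * f (par n)) := by simp only [mul_assoc]
      _ = f (n + 1) * (x n * f (par n) * star (x n)) * x n := by
        conv_lhs => rw [h.swap (hxG n) (fA _)]
        simp only [mul_assoc]
      _ = _ := by rw [le]

/-- `w n` is the path in the tree from the root to the vertex `f n`. -/
structure IsPath {R : Type*} [Ring R] (p : R) (par : ℕ → ℕ) (t w : ℕ → R) : Prop where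
  zero : w 0 = p
  succ : ∀ n, w (n + 1) = t n * w (par n)

namespace IsTree

variable {R : Type*} [Ring R] [StarRing R] {A G : Set R} {p : R} {par : ℕ → ℕ}
  {f t w : ℕ → R}

theorem exists_isPath (ht : IsTree A G p par f t) : ∃ w, IsPath p par t w := by
  obtain ⟨w, h0, h1⟩ := exists_sequence_of_step p (fun n w => t n * w (par n))
    (fun n f g hfg => by simp only [hfg _ (ht.par_le n)])
  exact ⟨w, h0, h1⟩

theorem induction (ht : IsTree A G p par f t) {P : ℕ → Prop} (h0 : P 0)
    (h1 : ∀ n, P (par n) → P (n + 1)) (n : ℕ) : P n := by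
  induction n using Nat.strong_induction_on with
  | _ n ih =>
    cases n with
    | zero => exact h0
    | succ n => exact h1 n (ih _ (Nat.lt_succ_of_le (ht.par_le n)))

theorem path_mem (ht : IsTree A G p par f t) (h : IsNormalizing A G) (hw : IsPath p par t w)
    (n : ℕ) : w n ∈ G := by
  refine ht.induction (P := fun n => w n ∈ G) ?_ (fun n ih => ?_) n
  · rw [hw.zero, ← ht.root]; exact h.proj_mem _ (ht.f_mem 0) (ht.f_proj 0)
  · rw [hw.succ]; exact h.g_mul _ (ht.t_mem n) _ ih

theorem path_mul_star (ht : IsTree A G p par f t) (hw : IsPath p par t w)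
    (n : ℕ) : w n * star (w n) = f n := by
  refine ht.induction (P := fun n => w n * star (w n) = f n) ?_ (fun n ih => ?_) n
  · rw [hw.zero, ← ht.root, (ht.f_proj 0).isSelfAdjoint.star_eq, (ht.f_proj 0).isIdempotentElem.eq]
  · calc w (n + 1) * star (w (n + 1)) = t n * (w (par n) * star (w (par n))) * star (t n) := by
          rw [hw.succ, star_mul]; simp only [mul_assoc]
      _ = f (n + 1) := by rw [ih, ht.mul_par, ht.lsupp]

theorem path_mul_root (ht : IsTree A G p par f t) (hw : IsPath p par t w)
    (n : ℕ) : w n * p = w n := by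
  refine ht.induction (P := fun n => w n * p = w n) ?_ (fun n ih => ?_) n
  · rw [hw.zero, ← ht.root, (ht.f_proj 0).isIdempotentElem.eq]
  · rw [hw.succ, mul_assoc, ih]

theorem star_root (ht : IsTree A G p par f t) : star p = p := by
  rw [← ht.root, (ht.f_proj 0).isSelfAdjoint.star_eq]

theorem root_mul_star_path (ht : IsTree A G p par f t) (hw : IsPath p par t w)
    (n : ℕ) : p * star (w n) = star (w n) := by
  conv_rhs => rw [← ht.path_mul_root hw n, star_mul, ht.star_root]

theorem mul_path (ht : IsTree A G p par f t) (h : IsNormalizing A G) (hw : IsPath p par t w)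
    (n : ℕ) : f n * w n = w n := by
  rw [← ht.path_mul_star hw, h.isom _ (ht.path_mem h hw n)]

theorem star_path_mul (ht : IsTree A G p par f t) (h : IsNormalizing A G) (hw : IsPath p par t w)
    (n : ℕ) : star (w n) * f n = star (w n) := by
  conv_rhs => rw [← ht.mul_path h hw n, star_mul, (ht.f_proj n).isSelfAdjoint.star_eq]

/-- The ranges of distinct paths are distinct vertices; this orthogonality makes amplification along
the paths possible. -/
theorem path_orth (ht : IsTree A G p par f t) (h : IsNormalizing A G) (hw : IsPath p par t w)
    {i j : ℕ} (hij : i ≠ j) : star (w i) * w j = 0 := by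
  rw [← ht.star_path_mul h hw, ← ht.mul_path h hw j, mul_assoc, ← mul_assoc (f i), ht.orth i j hij]
  simp

theorem f_mul_t (ht : IsTree A G p par f t) (h : IsNormalizing A G) (n : ℕ) :
    f (n + 1) * t n = t n := by
  rw [← ht.lsupp, h.isom _ (ht.t_mem n)]

end IsTree

end VNGroupoid

/-! ### Words, free groups and treeings. -/

namespace VNGroupoid

section Words

variable {H : Type*} [NormedAddCommGroup H] [InnerProductSpace ℂ H] [CompleteSpace H]
  {M : VonNeumannAlgebra H} {A G : Set (Elt M)} {ι κ : Type}

theorem wordVal_nil (v : ι → Elt M) : wordVal v [] = 1 := rfl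

theorem wordVal_cons (v : ι → Elt M) (l : ι × Bool) (w : List (ι × Bool)) :
    wordVal v (l :: w) = (if l.2 then v l.1 else star (v l.1)) * wordVal v w := by
  simp [wordVal]

theorem wordVal_singleton (v : ι → Elt M) (l : ι × Bool) :
    wordVal v [l] = if l.2 then v l.1 else star (v l.1) := by
  simp [wordVal]

theorem wordVal_append (v : ι → Elt M) (w w' : List (ι × Bool)) :
    wordVal v (w ++ w') = wordVal v w * wordVal v w' := by
  simp [wordVal]

theorem star_wordVal (v : ι → Elt M) (w : List (ι × Bool)) :
    star (wordVal v w) = wordVal v (FreeGroup.invRev w) := by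
  induction w with
  | nil => simp [wordVal, FreeGroup.invRev]
  | cons l w ih =>
    have : FreeGroup.invRev (l :: w) = FreeGroup.invRev w ++ [(l.1, !l.2)] := by
      simp [FreeGroup.invRev]
    rw [wordVal_cons, star_mul, ih, this, wordVal_append, wordVal_singleton]
    cases h : l.2 <;> simp

theorem letter_mem (h : IsNormalizing A G) {v : ι → Elt M} (hv : ∀ i, v i ∈ G) (l : ι × Bool) :
    (if l.2 then v l.1 else star (v l.1)) ∈ G := by
  split_ifs
  · exact hv _
  · exact h.g_star _ (hv _)

theorem wordVal_mem (h : IsNormalizing A G) {v : ι → Elt M} (hv : ∀ i, v i ∈ G)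
    (w : List (ι × Bool)) : wordVal v w ∈ G := by
  induction w with
  | nil => exact h.g_one
  | cons l w ih => rw [wordVal_cons]; exact h.g_mul _ (letter_mem h hv l) _ ih

/-- `x` is the value of the word `w` up to a left factor in `A`. -/
def IsMultiple (A : Set (Elt M)) (v : ι → Elt M) (x : Elt M) (w : List (ι × Bool)) : Prop :=
  ∃ a ∈ A, x = a * wordVal v w

namespace IsMultiple

variable {v : ι → Elt M} {x y : Elt M} {w w' : List (ι × Bool)}

theorem refl (h : IsNormalizing A G) (v : ι → Elt M) (w : List (ι × Bool)) :
    IsMultiple A v (wordVal v w) w := ⟨1, h.one_mem, (one_mul _).symm⟩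

theorem of_mem {a : Elt M} (ha : a ∈ A) (v : ι → Elt M) : IsMultiple A v a [] :=
  ⟨a, ha, (mul_one _).symm⟩

/-- Words take values in `G`, so the coefficient of the second factor can be moved to the left
through the first word. -/
theorem mul (h : IsNormalizing A G) (hv : ∀ i, v i ∈ G) (hx : IsMultiple A v x w)
    (hy : IsMultiple A v y w') : IsMultiple A v (x * y) (w ++ w') := by
  obtain ⟨a, ha, rfl⟩ := hx
  obtain ⟨b, hb, rfl⟩ := hy
  have hw := wordVal_mem h hv w
  refine ⟨_, h.mul_mem _ ha _ (h.conj_mem _ hw _ hb), ?_⟩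
  calc a * wordVal v w * (b * wordVal v w') = a * (wordVal v w * b) * wordVal v w' := by
        simp only [mul_assoc]
    _ = _ := by
      conv_lhs => rw [h.swap hw hb]
      rw [wordVal_append]
      simp only [mul_assoc]

theorem star (h : IsNormalizing A G) (hv : ∀ i, v i ∈ G) (hx : IsMultiple A v x w) :
    IsMultiple A v (star x) (FreeGroup.invRev w) := by
  obtain ⟨a, ha, rfl⟩ := hx
  have := (refl h v (FreeGroup.invRev w)).mul h hv (of_mem (h.star_mem a ha) v)
  rwa [List.append_nil, ← star_wordVal, ← star_mul] at this

/-- A cancelling pair of letters evaluates to a support projection, which lies in `A` and is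
absorbed by the coefficient. Hence free reduction is harmless up to `A`, although letters are not
invertible. -/
theorem of_step (h : IsNormalizing A G) (hv : ∀ i, v i ∈ G) (hx : IsMultiple A v x w)
    (hs : FreeGroup.Red.Step w w') : IsMultiple A v x w' := by
  obtain ⟨a, ha, rfl⟩ := hx
  cases hs with
  | @not L₁ L₂ i b =>
    have hl : wordVal v [(i, b), (i, !b)] ∈ A := by
      rw [wordVal_cons, wordVal_singleton]
      cases b
      · simpa using h.rsupp_mem (hv i)
      · simpa using h.lsupp_mem (hv i)
    have h1 := ((of_mem ha v).mul h hv (refl h v L₁)).mul h hv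
      ((of_mem hl v).mul h hv (refl h v L₂))
    rw [← wordVal_append, mul_assoc, ← wordVal_append] at h1
    simpa using h1

theorem of_red (h : IsNormalizing A G) (hv : ∀ i, v i ∈ G) (hx : IsMultiple A v x w)
    (hs : FreeGroup.Red w w') : IsMultiple A v x w' := by
  induction hs with
  | refl => exact hx
  | tail _ hs ih => exact ih.of_step h hv hs

end IsMultiple

/-- Substitution of words for letters. -/
def expand (φ : κ → List (ι × Bool)) (w : List (κ × Bool)) : List (ι × Bool) :=
  w.flatMap fun l => if l.2 then φ l.1 else FreeGroup.invRev (φ l.1)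

theorem isMultiple_expand (h : IsNormalizing A G) {v : ι → Elt M} (hv : ∀ i, v i ∈ G)
    {v' : κ → Elt M} {φ : κ → List (ι × Bool)} (hφ : ∀ k, IsMultiple A v (v' k) (φ k))
    (w : List (κ × Bool)) : IsMultiple A v (wordVal v' w) (expand φ w) := by
  induction w with
  | nil => exact IsMultiple.of_mem h.one_mem v
  | cons l w ih =>
    rw [wordVal_cons]
    refine IsMultiple.mul (w := if l.2 then φ l.1 else FreeGroup.invRev (φ l.1)) h hv ?_ ih
    split_ifs
    · exact hφ _
    · exact (hφ _).star h hv

/-- This turns freeness of substituted families into injectivity of a homomorphism of free groups.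
-/
theorem mk_expand (φ : κ → List (ι × Bool)) (w : List (κ × Bool)) :
    FreeGroup.mk (expand φ w) =
      FreeGroup.lift (fun k => FreeGroup.mk (φ k)) (FreeGroup.mk w) := by
  induction w with
  | nil => simp [expand, FreeGroup.one_eq_mk]
  | cons l w ih =>
    rw [FreeGroup.lift_mk] at ih ⊢
    rw [List.map_cons, List.prod_cons, ← ih]
    have : expand φ (l :: w) = (if l.2 then φ l.1 else FreeGroup.invRev (φ l.1)) ++ expand φ w := by
      simp [expand]
    rw [this, ← FreeGroup.mul_mk]
    cases hl : l.2 <;> simp [FreeGroup.inv_mk]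

theorem mk_ne_one_of_isReduced {w : List (ι × Bool)} (hw : w ≠ []) (hr : FreeGroup.IsReduced w) :
    FreeGroup.mk w ≠ 1 := by
  classical
  intro h
  rw [FreeGroup.one_eq_mk] at h
  have := FreeGroup.reduce.sound h
  rw [hr.reduce_eq] at this
  exact hw (by simpa using this)

variable {E : Elt M →ₗ[ℂ] Elt M}

/-- For a treeing, the expectation vanishes on multiples of words that are nontrivial in the free
group. -/
theorem IsTreeing.apply_eq_zero (h : IsNormalizing A G) (hE : ∀ a ∈ A, ∀ x, E (a * x) = a * E x)
    {v : ι → Elt M} (hv : ∀ i, v i ∈ G) (ht : IsTreeing E v) {x : Elt M} {w : List (ι × Bool)}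
    (hx : IsMultiple A v x w) (hw : FreeGroup.mk w ≠ 1) : E x = 0 := by
  classical
  obtain ⟨a, ha, rfl⟩ := hx.of_red h hv (FreeGroup.reduce.red (L := w))
  rw [hE a ha, ht _ _ (FreeGroup.isReduced_iff_reduce_eq.2 FreeGroup.reduce.idem), mul_zero]
  intro h0
  apply hw
  rw [← FreeGroup.reduce.self, h0, FreeGroup.one_eq_mk]

/-- A family that is free over a treeing is a treeing. -/
theorem IsTreeing.of_expand (h : IsNormalizing A G) (hE : ∀ a ∈ A, ∀ x, E (a * x) = a * E x)
    {v : ι → Elt M} (hv : ∀ i, v i ∈ G) (ht : IsTreeing E v) {v' : κ → Elt M}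
    {φ : κ → List (ι × Bool)} (hφ : ∀ k, IsMultiple A v (v' k) (φ k))
    (hinj : Function.Injective (FreeGroup.lift fun k => FreeGroup.mk (φ k))) :
    IsTreeing E v' := by
  intro w hw hr
  refine ht.apply_eq_zero h hE hv (isMultiple_expand h hv hφ w) ?_
  rw [mk_expand]
  intro h1
  exact mk_ne_one_of_isReduced hw hr (hinj (h1.trans (map_one _).symm))

/-- Cutting the members of a treeing by orthogonal projections yields a treeing. -/
theorem IsTreeing.cut (h : IsNormalizing A G) (hE : ∀ a ∈ A, ∀ x, E (a * x) = a * E x)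
    {v : ι → Elt M} (hv : ∀ i, v i ∈ G) (ht : IsTreeing E v) {f : ℕ → Elt M}
    (hfA : ∀ n, f n ∈ A) (hf : ∀ n, IsStarProjection (f n)) (horth : ∀ i j, i ≠ j → f i * f j = 0) :
    IsTreeing E (fun k : ι × ℕ × ℕ => f k.2.1 * v k.1 * f k.2.2) := by
  set P : ι × ℕ × ℕ → Elt M := fun k => f k.2.1 * v k.1 * f k.2.2 with hP
  have hmul : ∀ k, IsMultiple A v (P k) [(k.1, true)] := fun k => by
    simpa using ((IsMultiple.of_mem (hfA _) v).mul h hv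
      ⟨1, h.one_mem, by simp [wordVal_singleton]⟩ (w' := [(k.1, true)])).mul h hv
        (IsMultiple.of_mem (hfA k.2.2) v)
  have hexp : ∀ w : List ((ι × ℕ × ℕ) × Bool),
      expand (fun k : ι × ℕ × ℕ => [(k.1, true)]) w = w.map fun l => (l.1.1, l.2) := by
    intro w
    induction w with
    | nil => rfl
    | cons l w ih =>
      simp only [expand, List.flatMap_cons, List.map_cons] at ih ⊢
      rw [ih]
      cases hl : l.2 <;> simp [FreeGroup.invRev]
  -- Forgetting the cuts can spoil reducedness only where two different pieces of one `v i` meet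
  -- with opposite signs, and there the product is zero.
  have hzero : ∀ w, FreeGroup.IsReduced w → wordVal P w = 0 ∨
      FreeGroup.IsReduced (w.map fun l => (l.1.1, l.2)) := by
    intro w hr
    induction w with
    | nil => right; exact FreeGroup.IsReduced.nil
    | cons l w ih =>
      cases w with
      | nil => right; exact FreeGroup.IsReduced.singleton
      | cons l' w =>
        rw [FreeGroup.isReduced_cons_cons] at hr
        rcases ih hr.2 with h0 | h1
        · left; rw [wordVal_cons, h0, mul_zero]
        by_cases hl : l.1.1 = l'.1.1 → l.2 = l'.2
        · right
          exact FreeGroup.isReduced_cons_cons.2 ⟨hl, h1⟩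
        left
        push Not at hl
        obtain ⟨⟨i, a, b⟩, s⟩ := l
        obtain ⟨⟨i', a', b'⟩, s'⟩ := l'
        obtain ⟨rfl, hs⟩ : i = i' ∧ s ≠ s' := hl
        rw [wordVal_cons, wordVal_cons, ← mul_assoc]
        suffices hz : (if s then P (i, a, b) else star (P (i, a, b))) *
            (if s' then P (i, a', b') else star (P (i, a', b'))) = 0 by
          rw [hz, zero_mul]
        have hne : ¬ (a = a' ∧ b = b') := by
          rintro ⟨rfl, rfl⟩
          exact hs (hr.1 rfl)
        have hst : ∀ n, star (f n) = f n := fun n => (hf n).isSelfAdjoint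
        -- If the inner cuts differ they annihilate each other; if they agree, `u * f b * star u`
        -- lies in `A`, so the outer cuts can be brought together.
        have key : ∀ u ∈ G, ∀ a b a' b', ¬ (a = a' ∧ b = b') →
            f a * u * f b * (f b' * star u * f a') = 0 := by
          intro u hu a b a' b' hne
          by_cases hb : b = b'
          · subst hb
            have ha : a ≠ a' := fun ha => hne ⟨ha, rfl⟩
            have h1 := h.conj_mem u hu _ (hfA b)
            calc f a * u * f b * (f b * star u * f a')
                = f a * ((u * (f b * f b) * star u) * f a') := by simp only [mul_assoc]
              _ = 0 := by
                rw [(hf b).isIdempotentElem.eq, h.comm _ h1 _ (hfA _), ← mul_assoc,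
                  horth _ _ ha, zero_mul]
          · calc f a * u * f b * (f b' * star u * f a')
                = f a * u * (f b * f b') * (star u * f a') := by simp only [mul_assoc]
              _ = 0 := by rw [horth _ _ hb]; simp
        cases s <;> cases s'
        · exact absurd rfl hs
        · have := key (star (v i)) (h.g_star _ (hv i)) b a b' a' (fun hh => hne ⟨hh.2, hh.1⟩)
          simpa [hP, hst, mul_assoc] using this
        · have := key (v i) (hv i) a b a' b' hne
          simpa [hP, hst, mul_assoc] using this
        · exact absurd rfl hs
  intro w hw hr
  rcases hzero w hr with h0 | h1
  · rw [h0, map_zero]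
  · refine ht.apply_eq_zero h hE hv (isMultiple_expand h hv hmul w) ?_
    rw [hexp]
    exact mk_ne_one_of_isReduced (by simpa using hw) h1

/-- The words with nonzero value in a treeing of the corner together with a star of elements
`t n` leaving the corner. -/
theorem wordVal_elim_cases {v : ι → Elt M} {t : ℕ → Elt M}
    (h1 : ∀ m n, t m * t n = 0) (h2 : ∀ m n, m ≠ n → star (t m) * t n = 0)
    (h3 : ∀ i n, v i * t n = 0) (h4 : ∀ i n, star (v i) * t n = 0)
    (w : List ((ι ⊕ ℕ) × Bool)) (hr : FreeGroup.IsReduced w) :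
    wordVal (Sum.elim v t) w = 0 ∨
      ∃ (w' : List (ι × Bool)) (s e : List (ℕ × Bool)), FreeGroup.IsReduced w' ∧
        (s = [] ∨ ∃ n, s = [(n, true)]) ∧ (e = [] ∨ ∃ n, e = [(n, false)]) ∧
        w = s.map (fun l => (Sum.inr l.1, l.2)) ++ (w'.map (fun l => (Sum.inl l.1, l.2)) ++
          e.map fun l => (Sum.inr l.1, l.2)) := by
  have h5 : ∀ i n, star (t n) * v i = 0 := fun i n => by simpa using congrArg star (h4 i n)
  have h6 : ∀ i n, star (t n) * star (v i) = 0 := fun i n => by simpa using congrArg star (h3 i n)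
  have h7 : ∀ m n, star (t m) * star (t n) = 0 := fun m n => by simpa using congrArg star (h1 n m)
  induction w with
  | nil => right; exact ⟨[], [], [], FreeGroup.IsReduced.nil, Or.inl rfl, Or.inl rfl, rfl⟩
  | cons l w ih =>
    rcases ih (hr.infix ⟨[l], [], by simp⟩) with h0 | ⟨w', s, e, hr', hs, he, rfl⟩
    · left; rw [wordVal_cons, h0, mul_zero]
    obtain ⟨i | n, b⟩ := l
    · rcases hs with rfl | ⟨m, rfl⟩
      · right
        refine ⟨(i, b) :: w', [], e, ?_, Or.inl rfl, he, by simp⟩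
        cases w' with
        | nil => exact FreeGroup.IsReduced.singleton
        | cons l' w' =>
          refine FreeGroup.isReduced_cons_cons.2 ⟨?_, hr'⟩
          have := (FreeGroup.isReduced_cons_cons.1 hr).1
          simpa using this
      · left
        simp only [List.map_cons, List.map_nil, List.cons_append, wordVal_cons]
        rw [← mul_assoc]
        cases b <;> simp [h3, h4]
    · cases b
      · rcases hs with rfl | ⟨m, rfl⟩
        · cases w' with
          | nil =>
            rcases he with rfl | ⟨m, rfl⟩
            · right
              exact ⟨[], [], [(n, false)], FreeGroup.IsReduced.nil, Or.inl rfl,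
                Or.inr ⟨n, rfl⟩, rfl⟩
            · left
              simp [wordVal, h7]
          | cons l' w' =>
            left
            simp only [List.map_cons, List.map_nil, List.nil_append, List.cons_append, wordVal_cons]
            rw [← mul_assoc]
            cases l'.2 <;> simp [h5, h6]
        · left
          have hne : n ≠ m := by
            rintro rfl
            have := (FreeGroup.isReduced_cons_cons.1 hr).1
            simp at this
          simp only [List.map_cons, List.map_nil, List.cons_append, wordVal_cons]
          rw [← mul_assoc]
          simp [h2 n m hne]
      · rcases hs with rfl | ⟨m, rfl⟩
        · right
          exact ⟨w', [(n, true)], e, hr', Or.inr ⟨n, rfl⟩, he, by simp⟩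
        · left
          simp only [List.map_cons, List.map_nil, List.cons_append, wordVal_cons]
          rw [← mul_assoc]
          simp [h1]

end Words

end VNGroupoid

/-! ### Strong sums of operators, normality and commutants. -/

namespace VNGroupoid

open Filter Topology

variable {H : Type*} [NormedAddCommGroup H] [InnerProductSpace ℂ H]

section Operators

theorem commute_of_hasSum {x : ℕ → H →L[ℂ] H} {X T : H →L[ℂ] H}
    (hX : ∀ ξ, HasSum (fun n => x n ξ) (X ξ)) (hT : ∀ n, T * x n = x n * T) : T * X = X * T := by
  ext ξ
  have h1 := (hX ξ).mapL T
  have h2 := hX (T ξ)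
  have : (fun n => T (x n ξ)) = fun n => x n (T ξ) :=
    funext fun n => DFunLike.congr_fun (hT n) ξ
  rw [this] at h1
  exact h1.unique h2

/-- An operator is recovered from its matrix blocks by summing first over the column index, then
over the row index. -/
theorem eq_of_blocks {f : ℕ → H →L[ℂ] H} (hf : ∀ ξ, HasSum (fun n => f n ξ) ξ) {X Y : H →L[ℂ] H}
    (h : ∀ a b, f a * X * f b = f a * Y * f b) : X = Y := by
  have h1 : ∀ b, X * f b = Y * f b := by
    intro b
    ext ξ
    refine (hf ((X * f b) ξ)).unique ?_
    convert! hf ((Y * f b) ξ) using 2 with n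
    exact DFunLike.congr_fun (h n b) ξ
  ext ξ
  refine ((hf ξ).mapL X).unique ?_
  convert! (hf ξ).mapL Y using 2 with n
  exact DFunLike.congr_fun (h1 n) ξ

variable [CompleteSpace H]

theorem norm_le_one_of_isom {w : H →L[ℂ] H} (hw : w * star w * w = w) : ‖w‖ ≤ 1 := by
  have h1 : ‖star w * w‖ = ‖w‖ * ‖w‖ := CStarRing.norm_star_mul_self
  have h2 : ‖star (star w * w) * (star w * w)‖ = ‖star w * w‖ * ‖star w * w‖ :=
    CStarRing.norm_star_mul_self
  have h3 : star (star w * w) * (star w * w) = star w * w := by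
    rw [star_mul, star_star, mul_assoc, ← mul_assoc w, hw]
  rw [h3, h1] at h2
  by_contra! h
  have hc : 1 < ‖w‖ * ‖w‖ := by nlinarith
  nlinarith

/-- Bessel's inequality: with `η = ∑ w n (star (w n) ξ)`, both `⟨ξ, η⟩` and `‖η‖ ^ 2` equal the
left-hand side, and `‖ξ - η‖ ^ 2 ≥ 0`. -/
theorem sum_norm_sq_star_le {w : ℕ → H →L[ℂ] H} (hi : ∀ n, w n * star (w n) * w n = w n)
    (ho : ∀ i j, i ≠ j → star (w i) * w j = 0) (s : Finset ℕ) (ξ : H) :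
    ∑ n ∈ s, ‖star (w n) ξ‖ ^ 2 ≤ ‖ξ‖ ^ 2 := by
  set η := ∑ n ∈ s, w n (star (w n) ξ) with hη
  have hadj : ∀ n (x y : H), inner ℂ (w n x) y = inner ℂ x (star (w n) y) := fun n x y => by
    rw [ContinuousLinearMap.star_eq_adjoint, ContinuousLinearMap.adjoint_inner_right]
  have hS : inner ℂ η ξ = ((∑ n ∈ s, ‖star (w n) ξ‖ ^ 2 : ℝ) : ℂ) := by
    rw [hη, sum_inner]
    push_cast
    refine Finset.sum_congr rfl fun n _ => ?_
    rw [hadj, inner_self_eq_norm_sq_to_K]; rfl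
  have hse : ∀ n ∈ s, star (w n) η = star (w n) ξ := by
    intro n hn
    rw [hη, map_sum, Finset.sum_eq_single n]
    · have := congrArg star (hi n)
      simp only [star_mul, star_star, ← mul_assoc] at this
      exact DFunLike.congr_fun this ξ
    · intro m _ hm
      exact DFunLike.congr_fun (ho n m hm.symm) (star (w m) ξ)
    · exact fun h => absurd hn h
  have hηη : inner ℂ η η = ((∑ n ∈ s, ‖star (w n) ξ‖ ^ 2 : ℝ) : ℂ) := by
    conv_lhs => rw [hη, ← hη, sum_inner]
    push_cast
    refine Finset.sum_congr rfl fun n hn => ?_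
    rw [hadj, hse n hn, inner_self_eq_norm_sq_to_K]; rfl
  have h1 : ‖ξ - η‖ ^ 2 = ‖ξ‖ ^ 2 - 2 * Complex.re (inner ℂ ξ η) + ‖η‖ ^ 2 := norm_sub_sq (𝕜 := ℂ) ξ η
  have h2 : Complex.re (inner ℂ ξ η) = ∑ n ∈ s, ‖star (w n) ξ‖ ^ 2 := by
    rw [← inner_conj_symm, hS, Complex.conj_ofReal, Complex.ofReal_re]
  have h3 : ‖η‖ ^ 2 = ∑ n ∈ s, ‖star (w n) ξ‖ ^ 2 := by
    have := inner_self_eq_norm_sq (𝕜 := ℂ) η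
    rw [hηη] at this
    exact this.symm.trans (Complex.ofReal_re _)
  nlinarith [sq_nonneg ‖ξ - η‖]

/-- Amplification of an operator along partial isometries with orthogonal ranges. -/
theorem exists_strongSum {w : ℕ → H →L[ℂ] H} (hi : ∀ n, w n * star (w n) * w n = w n)
    (ho : ∀ i j, i ≠ j → star (w i) * w j = 0) (T : H →L[ℂ] H) :
    ∃ T' : H →L[ℂ] H, ∀ ξ, HasSum (fun n => (w n * T * star (w n)) ξ) (T' ξ) := by
  have hsum : ∀ ξ, Summable fun n => (w n * T * star (w n)) ξ := by
    intro ξ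
    let K : ℕ → Submodule ℂ H := fun n => LinearMap.range (w n).toLinearMap
    have hK : OrthogonalFamily ℂ (fun n => K n) fun n => (K n).subtypeₗᵢ := by
      intro i j hij x y
      obtain ⟨_, x, rfl⟩ := x
      obtain ⟨_, y, rfl⟩ := y
      change inner ℂ (w i x) (w j y) = 0
      rw [← ContinuousLinearMap.adjoint_inner_right, ← ContinuousLinearMap.star_eq_adjoint]
      have := DFunLike.congr_fun (ho i j hij) y
      change star (w i) (w j y) = 0 at this
      rw [this, inner_zero_right]
    have := (hK.summable_iff_norm_sq_summable fun n => ⟨w n (T (star (w n) ξ)), _, rfl⟩).2 ?_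
    · exact this
    · change Summable fun n => ‖w n (T (star (w n) ξ))‖ ^ 2
      refine Summable.of_nonneg_of_le (fun n => by positivity) (fun n => ?_)
        ((summable_of_sum_le (fun n => by positivity)
          (fun s => sum_norm_sq_star_le hi ho s ξ)).mul_left (‖T‖ ^ 2))
      rw [← mul_pow]
      gcongr
      calc ‖w n (T (star (w n) ξ))‖ ≤ 1 * ‖T (star (w n) ξ)‖ :=
            (w n).le_of_opNorm_le (norm_le_one_of_isom (hi n)) _
        _ ≤ _ := by rw [one_mul]; exact T.le_opNorm _
  -- Boundedness of the pointwise limit is Banach–Steinhaus.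
  refine ⟨continuousLinearMapOfTendsto (l := atTop)
    (fun s : Finset ℕ => ∑ n ∈ s, w n * T * star (w n))
    (f := fun ξ => ∑' n, (w n * T * star (w n)) ξ) ?_, fun ξ => (hsum ξ).hasSum⟩
  rw [tendsto_pi_nhds]
  intro ξ
  simpa [HasSum] using (hsum ξ).hasSum

end Operators

section Elements

variable [CompleteSpace H] {M : VonNeumannAlgebra H}

/-- Dominated convergence in the series defining `φ`: the uniform bound `C` on partial sums gives
the summable majorant `C * (‖ξ k‖ ^ 2 + ‖η k‖ ^ 2)`. -/
theorem IsNormalFunctional.hasSum {φ : Elt M →ₗ[ℂ] ℂ} (hφ : IsNormalFunctional φ)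
    {x : ℕ → Elt M} {y : Elt M} {C : ℝ}
    (hx : ∀ ξ : H, HasSum (fun n => (x n : H →L[ℂ] H) ξ) ((y : H →L[ℂ] H) ξ))
    (hb : ∀ s : Finset ℕ, ‖((∑ n ∈ s, x n : Elt M) : H →L[ℂ] H)‖ ≤ C) :
    HasSum (fun n => φ (x n)) (φ y) := by
  obtain ⟨ξ, η, hξ, hη, h⟩ := hφ
  have hC : 0 ≤ C := (norm_nonneg _).trans (hb ∅)
  have hh : ∀ s : Finset ℕ, ∑ n ∈ s, φ (x n) =
      ∑' k, inner ℂ (ξ k) (((∑ n ∈ s, x n : Elt M) : H →L[ℂ] H) (η k)) := fun s => by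
    rw [← map_sum, h]
  rw [HasSum, h]
  simp only [hh]
  refine tendsto_tsum_of_dominated_convergence (bound := fun k => C * (‖ξ k‖ ^ 2 + ‖η k‖ ^ 2))
    ((hξ.add hη).mul_left C) (fun k => ?_) (Eventually.of_forall fun s k => ?_)
  · refine Tendsto.inner tendsto_const_nhds ?_
    have := hx (η k)
    rw [HasSum] at this
    refine this.congr fun s => ?_
    rw [AddSubmonoidClass.coe_finsetSum, sum_apply]
  · calc ‖inner ℂ (ξ k) (((∑ n ∈ s, x n : Elt M) : H →L[ℂ] H) (η k))‖
        ≤ ‖ξ k‖ * ‖((∑ n ∈ s, x n : Elt M) : H →L[ℂ] H) (η k)‖ := norm_inner_le_norm _ _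
      _ ≤ ‖ξ k‖ * (C * ‖η k‖) := by
        gcongr
        exact ContinuousLinearMap.le_of_opNorm_le _ (hb s) _
      _ ≤ C * (‖ξ k‖ ^ 2 + ‖η k‖ ^ 2) := by
        have : ‖ξ k‖ * ‖η k‖ ≤ ‖ξ k‖ ^ 2 + ‖η k‖ ^ 2 := by
          nlinarith [sq_nonneg (‖ξ k‖ - ‖η k‖), sq_nonneg ‖ξ k‖, sq_nonneg ‖η k‖]
        nlinarith

theorem isStarProjection_sum {R : Type*} [Ring R] [StarRing R] {f : ℕ → R}
    (hf : ∀ n, IsStarProjection (f n))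
    (ho : ∀ i j, i ≠ j → f i * f j = 0) (s : Finset ℕ) : IsStarProjection (∑ n ∈ s, f n) := by
  constructor
  · rw [IsIdempotentElem, Finset.sum_mul]
    refine Finset.sum_congr rfl fun n hn => ?_
    rw [Finset.mul_sum, Finset.sum_eq_single n (fun m _ hm => ho n m hm.symm)
      (fun h => absurd hn h), (hf n).isIdempotentElem.eq]
  · rw [IsSelfAdjoint, star_sum]
    exact Finset.sum_congr rfl fun n _ => (hf n).isSelfAdjoint

theorem isom_of_isStarProjection {R : Type*} [Mul R] [Star R] {e : R} (he : IsStarProjection e) :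
    e * star e * e = e := by
  rw [he.isSelfAdjoint.star_eq, he.isIdempotentElem.eq, he.isIdempotentElem.eq]

theorem IsNormalFunctional.hasSum_mul {φ : Elt M →ₗ[ℂ] ℂ} (hφ : IsNormalFunctional φ)
    {f : ℕ → Elt M} (hf : ∀ n, IsStarProjection (f n))
    (ho : ∀ i j, i ≠ j → f i * f j = 0) {Q : Elt M}
    (hQ : ∀ ξ : H, HasSum (fun n => (f n : H →L[ℂ] H) ξ) ((Q : H →L[ℂ] H) ξ)) (y : Elt M) :
    HasSum (fun n => φ (f n * y)) (φ (Q * y)) := by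
  refine hφ.hasSum (C := ‖(y : H →L[ℂ] H)‖) (fun ξ => hQ ((y : H →L[ℂ] H) ξ)) fun s => ?_
  rw [← Finset.sum_mul]
  change ‖((∑ n ∈ s, f n : Elt M) : H →L[ℂ] H) * (y : H →L[ℂ] H)‖ ≤ _
  refine (norm_mul_le _ _).trans ?_
  have h1 := isom_of_isStarProjection (isStarProjection_sum hf ho s)
  have : ‖((∑ n ∈ s, f n : Elt M) : H →L[ℂ] H)‖ ≤ 1 :=
    norm_le_one_of_isom (congrArg Subtype.val h1)
  nlinarith [norm_nonneg (y : H →L[ℂ] H)]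

theorem mem_of_commute {X : H →L[ℂ] H}
    (h : ∀ T : H →L[ℂ] H, (∀ x : Elt M, T * x = x * T) → T * X = X * T) : X ∈ M := by
  have : X ∈ (M : Set (H →L[ℂ] H)) := by
    rw [← M.centralizer_centralizer, Set.mem_centralizer_iff]
    intro T hT
    exact h T fun x => (Set.mem_centralizer_iff.1 hT x x.2).symm
  exact this

/-- The sum of a sequence of orthogonal projections of `M`. -/
theorem exists_sum_projections {f : ℕ → Elt M} (hf : ∀ n, IsStarProjection (f n))
    (ho : ∀ i j, i ≠ j → f i * f j = 0) :
    ∃ Q : Elt M, IsStarProjection Q ∧ (∀ n, Q * f n = f n) ∧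
      ∀ ξ : H, HasSum (fun n => (f n : H →L[ℂ] H) ξ) ((Q : H →L[ℂ] H) ξ) := by
  obtain ⟨Q, hQ⟩ := exists_strongSum (w := fun n => (f n : H →L[ℂ] H))
    (fun n => congrArg Subtype.val (isom_of_isStarProjection (hf n)))
    (fun i j hij => by
      have := ho i j hij
      rw [← (hf i).isSelfAdjoint.star_eq] at this
      exact congrArg Subtype.val this) 1
  have hQ' : ∀ ξ : H, HasSum (fun n => (f n : H →L[ℂ] H) ξ) (Q ξ) := by
    intro ξ
    convert! hQ ξ using 2 with n
    have : f n * 1 * star (f n) = f n := by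
      rw [mul_one, (hf n).isSelfAdjoint.star_eq, (hf n).isIdempotentElem.eq]
    exact (DFunLike.congr_fun (congrArg Subtype.val this) ξ).symm
  have hM : Q ∈ M := mem_of_commute fun T hT => commute_of_hasSum hQ' fun n => hT _
  have hQf : ∀ n, Q * (f n : H →L[ℂ] H) = f n := by
    intro n
    ext ξ
    refine (hQ' _).unique ?_
    convert! hasSum_ite_eq n ((f n : H →L[ℂ] H) ξ) using 2 with m
    split_ifs with hm
    · subst hm
      exact DFunLike.congr_fun (congrArg Subtype.val (hf m).isIdempotentElem.eq) ξ
    · exact DFunLike.congr_fun (congrArg Subtype.val (ho m n hm)) ξ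
  refine ⟨⟨Q, hM⟩, ⟨Subtype.ext ?_, Subtype.ext ?_⟩, fun n => Subtype.ext (hQf n), hQ'⟩
  · change Q * Q = Q
    ext ξ
    refine ((hQ' ξ).mapL Q).unique ?_
    convert! hQ' ξ using 2 with n
    exact DFunLike.congr_fun (hQf n) ξ
  · change star Q = Q
    ext ξ
    refine ext_inner_left ℂ fun η => ?_
    rw [ContinuousLinearMap.star_eq_adjoint, ContinuousLinearMap.adjoint_inner_right]
    have h1 : HasSum (fun n => inner ℂ ((f n : H →L[ℂ] H) η) ξ) (inner ℂ (Q η) ξ) := by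
      simpa using ((hQ' η).mapL (innerSL ℂ ξ)).star
    have h2 : HasSum (fun n => inner ℂ η ((f n : H →L[ℂ] H) ξ)) (inner ℂ η (Q ξ)) :=
      (hQ' ξ).mapL (innerSL ℂ η)
    refine h1.unique ?_
    convert! h2 using 2 with n
    have : star (f n : H →L[ℂ] H) = f n := congrArg Subtype.val (hf n).isSelfAdjoint.star_eq
    rw [← ContinuousLinearMap.adjoint_inner_right, ← ContinuousLinearMap.star_eq_adjoint, this]

/-- `T` commutes with the elements of `S` and with their adjoints. -/
def Centralizes (T : H →L[ℂ] H) (S : Set (Elt M)) : Prop :=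
  ∀ y ∈ S, T * (y : H →L[ℂ] H) = y * T ∧
    T * ((star y : Elt M) : H →L[ℂ] H) = ((star y : Elt M) : H →L[ℂ] H) * T

theorem mem_centralizer_iff_centralizes {T : H →L[ℂ] H} {S : Set (Elt M)} {e : Elt M} :
    T ∈ Set.centralizer ((fun y : Elt M => (y : H →L[ℂ] H)) '' (S ∪ star S ∪ {e})) ↔
      Centralizes T S ∧ T * (e : H →L[ℂ] H) = e * T := by
  rw [Set.mem_centralizer_iff, Set.forall_mem_image]
  constructor
  · intro h
    refine ⟨fun y hy => ⟨(h (Or.inl (Or.inl hy))).symm, (h (x := star y) (Or.inl (Or.inr ?_))).symm⟩,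
      (h (Or.inr rfl)).symm⟩
    simpa using hy
  · rintro ⟨h, he⟩ y ((hy | hy) | rfl)
    · exact (h y hy).1.symm
    · have := (h (star y) hy).2
      rw [star_star] at this
      exact this.symm
    · exact he.symm

theorem IsGraphing.commute {e : Elt M} {B G : Set (Elt M)} {ι : Type} {u : ι → Elt M}
    (h : IsGraphing e B G u) {T : H →L[ℂ] H} (hB : Centralizes T B)
    (hu : Centralizes T (Set.range u)) (he : T * (e : H →L[ℂ] H) = e * T) {y : Elt M} (hy : y ∈ G)
    (h1 : e * y = y) (h2 : y * e = y) : T * (y : H →L[ℂ] H) = y * T := by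
  have hyg : (y : H →L[ℂ] H) ∈ generated e G :=
    ⟨congrArg Subtype.val h1, congrArg Subtype.val h2, Set.subset_centralizer_centralizer
      ⟨y, Or.inl (Or.inl hy), rfl⟩⟩
  rw [h.2] at hyg
  refine Set.mem_centralizer_iff.1 hyg.2.2 T (mem_centralizer_iff_centralizes.2 ⟨?_, he⟩)
  rintro y (hy | hy)
  · exact hB y hy
  · exact hu y hy

/-- Two sets with the same commutant have the same bicommutant, so graphings can be recognized by
testing commuting operators. -/
theorem isGraphing_of_centralizes {e : Elt M} {B G : Set (Elt M)} {ι : Type} {u : ι → Elt M}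
    (hu : ∀ i, u i ∈ G)
    (h1 : ∀ T : H →L[ℂ] H, Centralizes T G → T * (e : H →L[ℂ] H) = e * T → Centralizes T B)
    (h2 : ∀ T : H →L[ℂ] H, Centralizes T B → Centralizes T (Set.range u) →
      T * (e : H →L[ℂ] H) = e * T → Centralizes T G) : IsGraphing e B G u := by
  refine ⟨hu, ?_⟩
  have : Set.centralizer ((fun y : Elt M => (y : H →L[ℂ] H)) '' (G ∪ star G ∪ {e})) =
      Set.centralizer ((fun y : Elt M => (y : H →L[ℂ] H)) ''
        ((B ∪ Set.range u) ∪ star (B ∪ Set.range u) ∪ {e})) := by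
    ext T
    rw [mem_centralizer_iff_centralizes, mem_centralizer_iff_centralizes]
    constructor
    · rintro ⟨hT, he⟩
      refine ⟨?_, he⟩
      rintro y (hy | ⟨i, rfl⟩)
      · exact h1 T hT he y hy
      · exact hT _ (hu i)
    · rintro ⟨hT, he⟩
      exact ⟨h2 T (fun y hy => hT y (Or.inl hy)) (fun y hy => hT y (Or.inr hy)) he, he⟩
  simp only [generated, this]

end Elements

end VNGroupoid

/-! ### Existence of complete trees, and amplification from the corner. -/

namespace VNGroupoid

open Filter Topology

variable {H : Type*} [NormedAddCommGroup H] [InnerProductSpace ℂ H] [CompleteSpace H]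
  {M A : VonNeumannAlgebra H} {G : Set (Elt M)} {p : Elt M} {par : ℕ → ℕ} {f t w : ℕ → Elt M}
  {τ : Elt M →ₗ[ℂ] ℂ} {E : Elt M →ₗ[ℂ] Elt M}

theorem IsGroupoid.isNormalizing (hG : IsGroupoid M A E G) (hτ : IsFaithfulTracialState τ)
    (hA : ∀ a ∈ A, ∀ b ∈ A, a * b = b * a) : IsNormalizing (subalg M A) G where
  comm a ha b hb := Subtype.ext (hA _ ha _ hb)
  one_mem := one_mem A
  mul_mem a ha b hb := MulMemClass.mul_mem (s := A) ha hb
  sub_mem a ha b hb := sub_mem (S := VonNeumannAlgebra H) (H := A) ha hb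
  star_mem a ha := StarMemClass.star_mem (s := A) ha
  isom u hu := by
    have h1 : star u * u * (star u * u) = star u * u :=
      (hG.subset_full hu).1.2.isIdempotentElem.eq
    -- Since `star u * u` is idempotent, `x = u * star u * u - u` satisfies `star x * x = 0`;
    -- faithfulness of the trace gives the partial isometry identity.
    have h2 := hτ.faithful (u * star u * u - u) (by
      have : star (u * star u * u - u) * (u * star u * u - u) =
          star u * u * (star u * u) * (star u * u) - star u * u * (star u * u)
            - star u * u * (star u * u) + star u * u := by
        simp only [star_sub, star_mul, star_star]
        noncomm_ring
      rw [this, h1, h1]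
      simp)
    exact sub_eq_zero.1 h2
  g_mul := hG.mul_mem
  g_star := hG.star_mem
  conj_mem u hu a ha := by
    have h := (hG.subset_full hu).2
    have h1 : u * a * star u ∈ (fun a => u * a * star u) '' subalg M A := ⟨a, ha, rfl⟩
    rw [h.2] at h1
    obtain ⟨b, hb, hb'⟩ := h1
    rw [← hb']
    exact MulMemClass.mul_mem (s := A) hb h.1.1
  proj_mem a ha hp := hG.partialIsometry_mem ⟨ha, by
    rwa [hp.isSelfAdjoint.star_eq, hp.isIdempotentElem.eq]⟩

/-- The sequence `f` sums up to `1` in the strong operator topology. -/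
def IsComplete (f : ℕ → Elt M) : Prop := ∀ ξ : H, HasSum (fun n => (f n : H →L[ℂ] H) ξ) ξ

section Exhaustion

theorem mul_strongSum_eq {Q v : Elt M}
    (hQ : ∀ ξ : H, HasSum (fun n => (f n : H →L[ℂ] H) ξ) ((Q : H →L[ℂ] H) ξ))
    (hv : ∀ k, Q * (v * f k) = v * f k) : Q * v * Q = v * Q := by
  refine Subtype.ext (ContinuousLinearMap.ext fun ξ => ?_)
  refine ((hQ ξ).mapL ((Q : H →L[ℂ] H) * (v : H →L[ℂ] H))).unique ?_
  have h1 : HasSum (fun n => (v : H →L[ℂ] H) ((f n : H →L[ℂ] H) ξ))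
      (((v * Q : Elt M) : H →L[ℂ] H) ξ) := (hQ ξ).mapL (v : H →L[ℂ] H)
  convert! h1 using 2 with n
  exact DFunLike.congr_fun (congrArg Subtype.val (hv n)) ξ

/-- Invariance of the range of `Q` under a self-adjoint generating family makes `Q` commute with it.
So `Q` is central, and it majorizes the root, whose central support is `1`. -/
theorem IsTree.eq_one_of_invariant (ht : IsTree (subalg M A) G p par f t)
    (h : IsNormalizing (subalg M A) G)
    (hpc : IsCentralSupport p 1) {Q : Elt M} (hQp : IsStarProjection Q) (hQf : ∀ n, Q * f n = f n)
    (hQ : ∀ ξ : H, HasSum (fun n => (f n : H →L[ℂ] H) ξ) ((Q : H →L[ℂ] H) ξ)) {S : Set (Elt M)}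
    (hgen : ∀ T : H →L[ℂ] H, Centralizes T (subalg M A) → Centralizes T S →
      ∀ x : Elt M, T * (x : H →L[ℂ] H) = x * T)
    (hS : ∀ u ∈ S, ∀ k, Q * (u * f k) = u * f k ∧ Q * (star u * f k) = star u * f k) : Q = 1 := by
  have key : ∀ v : Elt M, (∀ k, Q * (v * f k) = v * f k) →
      (∀ k, Q * (star v * f k) = star v * f k) → Q * v = v * Q := by
    intro v h1 h2
    have h3 := mul_strongSum_eq hQ h1
    have h4 := congrArg star (mul_strongSum_eq hQ h2)
    simp only [star_mul, star_star, hQp.isSelfAdjoint.star_eq, ← mul_assoc] at h4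
    rw [← h4, h3]
  have hA : ∀ a ∈ subalg M A, ∀ k, Q * (a * f k) = a * f k := fun a ha k => by
    rw [h.comm a ha _ (ht.f_mem k), ← mul_assoc, hQf]
  have hAc : ∀ a ∈ subalg M A, Q * a = a * Q := fun a ha =>
    key a (hA a ha) (hA _ (h.star_mem a ha))
  have hSc : ∀ u ∈ S, Q * u = u * Q ∧ Q * star u = star u * Q := fun u hu =>
    ⟨key u (fun k => (hS u hu k).1) fun k => (hS u hu k).2,
      key (star u) (fun k => (hS u hu k).2) fun k => by rw [star_star]; exact (hS u hu k).1⟩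
  have hc : ∀ x : Elt M, Q * x = x * Q := fun x => Subtype.ext <| hgen Q
    (fun a ha => ⟨congrArg Subtype.val (hAc a ha),
      congrArg Subtype.val (hAc _ (h.star_mem a ha))⟩)
    (fun u hu => ⟨congrArg Subtype.val (hSc u hu).1, congrArg Subtype.val (hSc u hu).2⟩) x
  have := hpc.2 Q hQp hc (by rw [← hc, ← ht.root, hQf])
  rwa [one_mul] at this

theorem tau_projection (hτ : IsFaithfulTracialState τ) {e : Elt M} (he : IsStarProjection e) :
    0 ≤ (τ e).re ∧ (τ e).re ≤ 1 := by
  have h1 : ∀ e : Elt M, IsStarProjection e → 0 ≤ (τ e).re := fun e he => by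
    have := hτ.nonneg_re e
    rwa [he.isSelfAdjoint.star_eq, he.isIdempotentElem.eq] at this
  refine ⟨h1 e he, ?_⟩
  have := h1 _ he.one_sub
  rw [map_sub, hτ.map_one] at this
  simpa using this

theorem IsTree.sum_projection (ht : IsTree (subalg M A) G p par f t) (s : Finset ℕ) :
    IsStarProjection (∑ k ∈ s, f k) := isStarProjection_sum ht.f_proj ht.orth s

/-- The root `p` of central support `1` is connected to the whole unit by a tree of height one
in `G`. -/
theorem exists_complete_star (h : IsNormalizing (subalg M A) G) (hτ : IsFaithfulTracialState τ)
    (hgen : ∀ T : H →L[ℂ] H, Centralizes T G → ∀ x : Elt M, T * (x : H →L[ℂ] H) = x * T)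
    (hp : p ∈ projections M A) (hpc : IsCentralSupport p 1) :
    ∃ f t, IsTree (subalg M A) G p (fun _ => 0) f t ∧ IsComplete f := by
  classical
  -- The trace of the part of `u * p * star u` not yet covered by `B`, that is, the mass gained by
  -- choosing `u`.
  let val : Elt M → Elt M → ℝ := fun B u => (τ (u * p * star u * (1 - B))).re
  have hproj : ∀ B ∈ subalg M A, IsStarProjection B → ∀ u ∈ G,
      IsStarProjection (u * p * star u * (1 - B)) := fun B hB hBp u hu =>
    (h.conj_proj hu hp.1 hp.2).mul hBp.one_sub
      (h.comm _ (h.conj_mem u hu p hp.1) _ (h.sub_mem _ h.one_mem _ hB))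
  have hchoice : ∀ B ∈ subalg M A, IsStarProjection B →
      ∃ u ∈ G, ∀ v ∈ G, val B v ≤ 2 * val B u := by
    intro B hB hBp
    have hne : (val B '' G).Nonempty := ⟨_, 1, h.g_one, rfl⟩
    have hbd : BddAbove (val B '' G) := by
      refine ⟨1, ?_⟩
      rintro _ ⟨u, hu, rfl⟩
      exact (tau_projection hτ (hproj B hB hBp u hu)).2
    -- The supremum need not be attained, hence the factor `2`. When it is not positive nothing can
    -- be gained, and `1` serves.
    by_cases hs : sSup (val B '' G) ≤ 0
    · refine ⟨1, h.g_one, fun v hv => (le_csSup hbd ⟨v, hv, rfl⟩).trans (hs.trans ?_)⟩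
      exact mul_nonneg zero_le_two (tau_projection hτ (hproj B hB hBp 1 h.g_one)).1
    · push Not at hs
      obtain ⟨_, ⟨u, hu, rfl⟩, hlt⟩ := exists_lt_of_lt_csSup hne (half_lt_self hs)
      exact ⟨u, hu, fun v hv => (le_csSup hbd ⟨v, hv, rfl⟩).trans (by linarith)⟩
  let X : ℕ → Elt M → Elt M := fun _ B =>
    if hB : ∃ u ∈ G, ∀ v ∈ G, val B v ≤ 2 * val B u then hB.choose else 1
  obtain ⟨f, x, hx, hf, hxG, ht⟩ := h.exists_isTree hp.1 hp.2 X (fun n B _ => by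
    simp only [X]
    split_ifs with hB
    · exact hB.choose_spec.1
    · exact h.g_one) (fun _ => 0) (fun _ => Nat.zero_le _)
  refine ⟨f, _, ht, ?_⟩
  obtain ⟨Q, hQp, hQf, hQ⟩ := exists_sum_projections ht.f_proj ht.orth
  have hBA : ∀ n, ∑ k ∈ Finset.range (n + 1), f k ∈ subalg M A := fun n => h.sum_mem _ _ ht.f_mem
  have hmax : ∀ n, ∀ v ∈ G,
      val (∑ k ∈ Finset.range (n + 1), f k) v ≤ 2 * (τ (f (n + 1))).re := by
    intro n v hv
    have hB := hchoice _ (hBA n) (ht.sum_projection _)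
    have h1 := hB.choose_spec.2 v hv
    have h2 : x n = hB.choose := by rw [hx n]; simp only [X]; rw [dif_pos hB]
    rw [← h2] at h1
    rw [hf n, ht.root]
    exact h1
  -- The gains are summable by normality of `τ`, so they tend to zero; by `hmax` no `v` in `G` can
  -- have positive gain over the full sum `Q`.
  have hlim : Tendsto (fun n => (τ (f (n + 1))).re) atTop (𝓝 0) := by
    have h1 := (hτ.normal.hasSum_mul ht.f_proj ht.orth hQ 1).summable.tendsto_atTop_zero
    simp only [mul_one] at h1
    have h2 := (Complex.continuous_re.tendsto 0).comp h1
    exact h2.comp (tendsto_add_atTop_nat 1)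
  have hQp' : ∀ v ∈ G, Q * (v * p) = v * p := by
    intro v hv
    set e := v * p * star v with he
    have heA : e ∈ subalg M A := h.conj_mem v hv p hp.1
    have hep : IsStarProjection e := h.conj_proj hv hp.1 hp.2
    have h1 := (hτ.normal.hasSum_mul ht.f_proj ht.orth hQ e).tendsto_sum_nat.comp
      (tendsto_add_atTop_nat 1)
    have h2 : Tendsto (fun n => val (∑ k ∈ Finset.range (n + 1), f k) v) atTop
        (𝓝 ((τ e).re - (τ (Q * e)).re)) := by
      have h3 := tendsto_const_nhds (x := (τ e).re) |>.sub ((Complex.continuous_re.tendsto _).comp h1)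
      refine h3.congr fun n => ?_
      simp only [Function.comp_apply, val]
      rw [← map_sum, ← Finset.sum_mul, ← Complex.sub_re, ← map_sub, h.comm _ (hBA n) _ heA,
        ← mul_one_sub]
    have h3 : (τ e).re - (τ (Q * e)).re ≤ 2 * 0 :=
      le_of_tendsto_of_tendsto' h2 (hlim.const_mul 2) fun n => hmax n v hv
    have hst : star (e * (1 - Q)) * (e * (1 - Q)) = (1 - Q) * e * (1 - Q) := by
      rw [star_mul, hQp.one_sub.isSelfAdjoint.star_eq, hep.isSelfAdjoint.star_eq]
      calc (1 - Q) * e * (e * (1 - Q)) = (1 - Q) * (e * e) * (1 - Q) := by simp only [mul_assoc]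
        _ = _ := by rw [hep.isIdempotentElem.eq]
    have h4 : (τ (star (e * (1 - Q)) * (e * (1 - Q)))).re = (τ e).re - (τ (Q * e)).re := by
      rw [hst, hτ.tracial, ← mul_assoc, hQp.one_sub.isIdempotentElem.eq, sub_mul, one_mul, map_sub,
        Complex.sub_re]
    have h5 := hτ.nonneg_re (e * (1 - Q))
    have h6 : e * (1 - Q) = 0 := hτ.faithful _ (Complex.ext
      (by rw [Complex.zero_re]; linarith) (hτ.im_eq_zero _))
    have h7 : Q * e = e := by
      have := congrArg star h6
      rw [star_mul, hQp.one_sub.isSelfAdjoint.star_eq, hep.isSelfAdjoint.star_eq, sub_mul, one_mul,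
        star_zero, sub_eq_zero] at this
      exact this.symm
    rw [h.swap hv hp.1, ← mul_assoc, h7]
  -- As the tree has height one, `v * f (k + 1) = (v * t k) * star (t k)` with `v * t k` in `G`
  -- starting at the root, which reduces to `hQp'`.
  have hinv : ∀ v ∈ G, ∀ k, Q * (v * f k) = v * f k := by
    intro v hv k
    cases k with
    | zero => rw [ht.root]; exact hQp' v hv
    | succ k =>
      have h1 := hQp' _ (h.g_mul v hv _ (ht.t_mem k))
      have h2 := ht.mul_par k
      rw [ht.root] at h2
      simp only [mul_assoc] at h1 h2
      rw [h2] at h1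
      rw [← ht.lsupp k]
      simp only [← mul_assoc] at h1 ⊢
      rw [h1]
  have hQ1 := ht.eq_one_of_invariant h hpc hQp hQf hQ (S := G) (fun T _ hT => hgen T hT)
    fun u hu k => ⟨hinv u hu k, hinv _ (h.g_star u hu) k⟩
  subst hQ1
  exact hQ

/-- The root `p` of central support `1` is connected to the whole unit by a tree cut out of a given
graphing. -/
theorem exists_complete_tree (h : IsNormalizing (subalg M A) G) {ι : Type} [Nonempty ι]
    [Countable ι] {u : ι → Elt M} (hu : ∀ i, u i ∈ G)
    (hgen : ∀ T : H →L[ℂ] H, Centralizes T (subalg M A) → Centralizes T (Set.range u) →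
      ∀ x : Elt M, T * (x : H →L[ℂ] H) = x * T)
    (hp : p ∈ projections M A) (hpc : IsCentralSupport p 1) :
    ∃ (par : ℕ → ℕ) (f t : ℕ → Elt M) (l : ℕ → ι × Bool), IsTree (subalg M A) G p par f t ∧
      IsComplete f ∧
      ∀ n, t n = f (n + 1) * (if (l n).2 then u (l n).1 else star (u (l n).1)) * f (par n) := by
  -- Step `n = Nat.pair m k` applies letter `g m` to vertex `f k`; here `k ≤ n`, so that vertex is
  -- already defined, and every letter is eventually tried on every vertex.
  obtain ⟨g, hg⟩ := exists_surjective_nat (ι × Bool)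
  let l : ℕ → ι × Bool := fun n => g n.unpair.1
  let par : ℕ → ℕ := fun n => n.unpair.2
  obtain ⟨f, x, hx, hf, hxG, ht⟩ := h.exists_isTree hp.1 hp.2
    (fun n _ => if (l n).2 then u (l n).1 else star (u (l n).1))
    (fun n _ _ => letter_mem h hu (l n)) par (fun n => Nat.unpair_right_le n)
  refine ⟨par, f, _, l, ht, ?_, fun n => ?_⟩
  swap
  · rw [← hx n]; exact (ht.mul_par n).symm
  obtain ⟨Q, hQp, hQf, hQ⟩ := exists_sum_projections ht.f_proj ht.orth
  have hinv : ∀ n, Q * (x n * f (par n)) = x n * f (par n) := by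
    intro n
    set B := ∑ k ∈ Finset.range (n + 1), f k with hB
    have hBA : B ∈ subalg M A := h.sum_mem _ _ ht.f_mem
    have hQB : Q * B = B := by
      rw [hB, Finset.mul_sum]
      exact Finset.sum_congr rfl fun k _ => hQf k
    have heA := h.conj_mem _ (hxG n) _ (ht.f_mem (par n))
    -- The image of the parent splits into the new vertex and a part under earlier vertices, both
    -- under `Q`.
    have h1 : x n * f (par n) * star (x n) = f (n + 1) + B * (x n * f (par n) * star (x n)) := by
      rw [hf n, ← hB, h.comm _ hBA _ heA, mul_one_sub]
      abel
    have h2 : Q * (x n * f (par n) * star (x n)) = x n * f (par n) * star (x n) := by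
      conv_lhs => rw [h1]
      rw [mul_add, hQf, ← mul_assoc, hQB, ← h1]
    rw [h.swap (hxG n) (ht.f_mem _), ← mul_assoc, h2]
  have hinv' : ∀ (i : ι) (b : Bool) k,
      Q * ((if b then u i else star (u i)) * f k) = (if b then u i else star (u i)) * f k := by
    intro i b k
    obtain ⟨m, hm⟩ := hg (i, b)
    have h1 := hinv (Nat.pair m k)
    rw [hx] at h1
    simpa [l, par, hm] using h1
  have hQ1 := ht.eq_one_of_invariant h hpc hQp hQf hQ (S := Set.range u) hgen (by
    rintro _ ⟨i, rfl⟩ k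
    exact ⟨by simpa using hinv' i true k, by simpa using hinv' i false k⟩)
  subst hQ1
  exact hQ

end Exhaustion

section Corner

theorem IsComplete.eq_of_blocks (hf : IsComplete f) {X Y : H →L[ℂ] H}
    (h : ∀ a b, (f a : H →L[ℂ] H) * X * f b = f a * Y * f b) : X = Y :=
  VNGroupoid.eq_of_blocks hf h

/-- An operator that commutes with the transports to the corner of a generating set commutes with
the corner. -/
theorem IsTree.commute_corner (ht : IsTree (subalg M A) G p par f t)
    (h : IsNormalizing (subalg M A) G) (hf : IsComplete f) (hw : IsPath p par t w)
    {S : Set (Elt M)} {T : H →L[ℂ] H} (hT : T * (p : H →L[ℂ] H) = p * T)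
    (hS : ∀ y ∈ S, ∀ a b, T * ((star (w a) * y * w b : Elt M) : H →L[ℂ] H) =
      ((star (w a) * y * w b : Elt M) : H →L[ℂ] H) * T)
    (hgen : ∀ T' : H →L[ℂ] H, (∀ y ∈ S, T' * (y : H →L[ℂ] H) = y * T') →
      ∀ x : Elt M, T' * (x : H →L[ℂ] H) = x * T') (x : Elt M) :
    T * ((p * x * p : Elt M) : H →L[ℂ] H) = ((p * x * p : Elt M) : H →L[ℂ] H) * T := by
  let W : ℕ → H →L[ℂ] H := fun n => w n
  have hi : ∀ n, W n * star (W n) * W n = W n := fun n =>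
    congrArg Subtype.val (h.isom _ (ht.path_mem h hw n))
  have ho : ∀ i j, i ≠ j → star (W i) * W j = 0 := fun i j hij =>
    congrArg Subtype.val (ht.path_orth h hw hij)
  have hff : ∀ n, (f n : H →L[ℂ] H) = W n * star (W n) := fun n =>
    congrArg Subtype.val (ht.path_mul_star hw n).symm
  -- `T'` copies `T` onto every vertex along its path. The block `f a * y * f b` commutes with it
  -- because the transport of `y` commutes with `T`, and `w 0 = p` gives back `T` on the corner.
  obtain ⟨T', hT'⟩ := exists_strongSum hi ho T
  have h1 : ∀ b, T' * W b = W b * T * (star (W b) * W b) := by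
    intro b
    ext ξ
    refine (hT' (W b ξ)).unique ?_
    convert! hasSum_ite_eq b ((W b * T * (star (W b) * W b)) ξ) using 2 with n
    split_ifs with hn
    · subst hn; rfl
    · have := DFunLike.congr_fun (ho n b hn) ξ
      change W n (T (star (W n) (W b ξ))) = 0
      change star (W n) (W b ξ) = 0 at this
      rw [this, map_zero, map_zero]
  have h2 : ∀ a, star (W a) * T' = star (W a) * W a * T * star (W a) := by
    intro a
    ext ξ
    refine ((hT' ξ).mapL (star (W a))).unique ?_
    convert! hasSum_ite_eq a ((star (W a) * W a * T * star (W a)) ξ) using 2 with n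
    split_ifs with hn
    · subst hn; rfl
    · exact DFunLike.congr_fun (ho a n (Ne.symm hn)) (T (star (W n) ξ))
  have h3 : ∀ y ∈ S, T' * (y : H →L[ℂ] H) = y * T' := by
    intro y hy
    refine hf.eq_of_blocks fun a b => ?_
    have hc : T * (star (W a) * (y : H →L[ℂ] H) * W b) = star (W a) * (y : H →L[ℂ] H) * W b * T :=
      hS y hy a b
    have hia := hi a
    have hib : star (W b) * W b * star (W b) = star (W b) := by
      simpa [mul_assoc] using congrArg star (hi b)
    rw [hff, hff]
    calc W a * star (W a) * (T' * y) * (W b * star (W b))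
        = W a * (star (W a) * T') * y * W b * star (W b) := by simp only [mul_assoc]
      _ = (W a * star (W a) * W a) * (T * (star (W a) * y * W b)) * star (W b) := by
        rw [h2]; simp only [mul_assoc]
      _ = W a * (star (W a) * y * W b) * T * (star (W b) * W b * star (W b)) := by
        rw [hia, hc, hib]; simp only [mul_assoc]
      _ = W a * star (W a) * y * (W b * T * (star (W b) * W b)) * star (W b) := by
        simp only [mul_assoc]
      _ = W a * star (W a) * (y * T') * (W b * star (W b)) := by
        rw [← h1]; simp only [mul_assoc]
  have hW0 : W 0 = (p : H →L[ℂ] H) := congrArg Subtype.val hw.zero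
  have hps : star (p : H →L[ℂ] H) = p := congrArg Subtype.val ht.star_root
  have hpp : (p : H →L[ℂ] H) * p = p := by
    have := (ht.f_proj 0).isIdempotentElem.eq
    rw [ht.root] at this
    exact congrArg Subtype.val this
  have h4 : T' * p = T * p := by
    have := h1 0
    rw [hW0, hps, hpp, mul_assoc, hT, ← mul_assoc, hpp] at this
    rw [this, hT]
  have h5 : (p : H →L[ℂ] H) * T' = p * T := by
    have := h2 0
    rw [hW0, hps, hpp, mul_assoc, hT, ← mul_assoc, hpp] at this
    exact this
  have h6 := hgen T' h3 (p * x * p)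
  change T' * ((p : H →L[ℂ] H) * x * p) = (p : H →L[ℂ] H) * x * p * T' at h6
  change T * ((p : H →L[ℂ] H) * x * p) = (p : H →L[ℂ] H) * x * p * T
  calc T * ((p : H →L[ℂ] H) * x * p) = T * p * x * p := by simp only [mul_assoc]
    _ = (p : H →L[ℂ] H) * x * p * T' := by rw [← h4, ← h6]; simp only [mul_assoc]
    _ = _ := by rw [mul_assoc, h5]; simp only [mul_assoc]

end Corner

end VNGroupoid

/-! ### Costs, extension of corner graphings and compression to the corner. -/

namespace VNGroupoid

open Filter Topology

variable {H : Type*} [NormedAddCommGroup H] [InnerProductSpace ℂ H] [CompleteSpace H]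
  {M A : VonNeumannAlgebra H} {G : Set (Elt M)} {p : Elt M} {par : ℕ → ℕ} {f t w : ℕ → Elt M}
  {τ : Elt M →ₗ[ℂ] ℂ} {E : Elt M →ₗ[ℂ] Elt M} {ι : Type}

section Cost

theorem familyCost_eq (hτ : IsFaithfulTracialState τ) (u : ι → Elt M) :
    familyCost τ u = ∑' i, ENNReal.ofReal (τ (u i * star (u i))).re := by
  refine tsum_congr fun i => ?_
  congr 1
  rw [lsupp, rsupp, map_add, hτ.tracial (star (u i)), Complex.add_re]
  ring

theorem tsum_ofReal_tau (hτ : IsFaithfulTracialState τ) (ht : IsTree (subalg M A) G p par f t)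
    (hf : IsComplete f) {y : Elt M} (hy : ∀ n, 0 ≤ (τ (f n * y)).re) :
    ∑' n, ENNReal.ofReal (τ (f n * y)).re = ENNReal.ofReal (τ y).re := by
  have h1 := hτ.normal.hasSum_mul (Q := 1) ht.f_proj ht.orth hf y
  rw [one_mul] at h1
  have h2 := Complex.hasSum_re h1
  rw [← h2.tsum_eq, ENNReal.ofReal_tsum_of_nonneg hy h2.summable]

/-- The masses of all vertices add up to `τ 1 = 1`, and the root accounts for `τ p`; this is the
cost of any complete tree. -/
theorem tsum_ofReal_tau_succ (hτ : IsFaithfulTracialState τ)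
    (ht : IsTree (subalg M A) G p par f t) (hf : IsComplete f) :
    ∑' n, ENNReal.ofReal (τ (f (n + 1))).re = ENNReal.ofReal (1 - (τ p).re) := by
  have h1 := hτ.normal.hasSum_mul (Q := 1) ht.f_proj ht.orth hf 1
  simp only [mul_one, hτ.map_one] at h1
  have h2 := (hasSum_nat_add_iff' 1).2 (Complex.hasSum_re h1)
  simp only [Finset.sum_range_one, ht.root, Complex.one_re] at h2
  rw [← h2.tsum_eq, ENNReal.ofReal_tsum_of_nonneg
    (fun n => (tau_projection hτ (ht.f_proj _)).1) h2.summable]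

end Cost

theorem corner_subset (h : IsNormalizing (subalg M A) G) (hp : p ∈ projections M A) :
    corner p G ⊆ G := by
  rintro _ ⟨u, hu, rfl⟩
  have hpG := h.proj_mem p hp.1 hp.2
  exact h.g_mul _ (h.g_mul _ hpG _ hu) _ hpG

theorem corner_subalg_subset (h : IsNormalizing (subalg M A) G) (hp : p ∈ projections M A) :
    corner p (subalg M A) ⊆ subalg M A := by
  rintro _ ⟨u, hu, rfl⟩
  exact h.mul_mem _ (h.mul_mem _ hp.1 _ hu) _ hp.1

theorem mem_corner {S : Set (Elt M)} {y : Elt M} (hy : y ∈ S) (h1 : p * y = y) (h2 : y * p = y) :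
    y ∈ corner p S := ⟨y, hy, by simp only [h1, h2]⟩

theorem mul_of_mem_corner (hp : IsStarProjection p) {S : Set (Elt M)} {y : Elt M}
    (hy : y ∈ corner p S) : p * y = y ∧ y * p = y := by
  obtain ⟨x, _, rfl⟩ := hy
  constructor
  · simp only [← mul_assoc, hp.isIdempotentElem.eq]
  · simp only [mul_assoc, hp.isIdempotentElem.eq]

theorem IsTree.transport_mul (ht : IsTree (subalg M A) G p par f t) (hw : IsPath p par t w)
    (a b : ℕ) (y : Elt M) :
    p * (star (w a) * y * w b) = star (w a) * y * w b ∧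
      star (w a) * y * w b * p = star (w a) * y * w b := by
  constructor
  · simp only [← mul_assoc, ht.root_mul_star_path hw]
  · rw [mul_assoc, ht.path_mul_root hw]

section Extend

variable {v : ι → Elt M}

/-- A graphing of the corner together with a star of elements leaving the corner is a graphing. -/
theorem IsGraphing.elim (h : IsNormalizing (subalg M A) G)
    (ht : IsTree (subalg M A) G p (fun _ => 0) f t) (hf : IsComplete f)
    (hgen : ∀ T : H →L[ℂ] H, Centralizes T G → ∀ x : Elt M, T * (x : H →L[ℂ] H) = x * T)
    (hp : p ∈ projections M A)
    (hv : IsGraphing p (corner p (subalg M A)) (corner p G) v) :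
    IsGraphing 1 (subalg M A) G (Sum.elim v t) := by
  refine isGraphing_of_centralizes ?_ (fun T hT _ y _ => ⟨hgen T hT _, hgen T hT _⟩) ?_
  · rintro (i | n)
    · exact corner_subset h hp (hv.1 i)
    · exact ht.t_mem n
  intro T hA hu _
  obtain ⟨w, hw⟩ := ht.exists_isPath
  have hTp : Commute T (p : H →L[ℂ] H) := (hA p hp.1).1
  have hTw : ∀ n, Commute T (w n : H →L[ℂ] H) ∧
      Commute T ((star (w n) : Elt M) : H →L[ℂ] H) := by
    intro n
    cases n with
    | zero => rw [hw.zero, ht.star_root]; exact ⟨hTp, hTp⟩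
    | succ n =>
      have h1 := hu (t n) ⟨Sum.inr n, rfl⟩
      rw [hw.succ, hw.zero, star_mul, ht.star_root]
      exact ⟨Commute.mul_right h1.1 hTp, hTp.mul_right h1.2⟩
  have hcor : ∀ y ∈ corner p G, Commute T (y : H →L[ℂ] H) := fun y hy =>
    hv.commute (fun y hy => hA y (corner_subalg_subset h hp hy))
      (by rintro _ ⟨i, rfl⟩; exact hu _ ⟨Sum.inl i, rfl⟩) hTp hy
      (mul_of_mem_corner hp.2 hy).1 (mul_of_mem_corner hp.2 hy).2
  have hG : ∀ y ∈ G, Commute T (y : H →L[ℂ] H) := by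
    intro y hy
    refine hf.eq_of_blocks fun a b => ?_
    have hTf : ∀ n, Commute T (f n : H →L[ℂ] H) := fun n => (hA _ (ht.f_mem n)).1
    have hmem : star (w a) * y * w b ∈ corner p G := mem_corner
      (h.g_mul _ (h.g_mul _ (h.g_star _ (ht.path_mem h hw a)) _ hy) _ (ht.path_mem h hw b))
      (ht.transport_mul hw a b y).1 (ht.transport_mul hw a b y).2
    -- Each block is a corner element carried along two paths, and `T` commutes with all three
    -- factors.
    have heq : f a * y * f b = w a * (star (w a) * y * w b) * star (w b) := by
      rw [← ht.path_mul_star hw, ← ht.path_mul_star hw]; simp only [mul_assoc]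
    have h1 : Commute T ((f a * y * f b : Elt M) : H →L[ℂ] H) := by
      rw [heq]
      exact ((hTw a).1.mul_right (hcor _ hmem)).mul_right (hTw b).2
    have h1' : T * ((f a : H →L[ℂ] H) * y * f b) = (f a : H →L[ℂ] H) * y * f b * T := h1
    calc (f a : H →L[ℂ] H) * (T * y) * f b = (f a * T) * y * f b := by simp only [mul_assoc]
      _ = T * ((f a : H →L[ℂ] H) * y * f b) := by rw [← (hTf a).eq]; simp only [mul_assoc]
      _ = (f a : H →L[ℂ] H) * y * (f b * T) := by rw [h1']; simp only [mul_assoc]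
      _ = _ := by rw [← (hTf b).eq]; simp only [mul_assoc]
  exact fun y hy => ⟨hG y hy, hG _ (h.g_star y hy)⟩

theorem familyCost_elim (hτ : IsFaithfulTracialState τ)
    (ht : IsTree (subalg M A) G p par f t) (hf : IsComplete f) :
    familyCost τ (Sum.elim v t) = familyCost τ v + ENNReal.ofReal (1 - (τ p).re) := by
  rw [familyCost_eq hτ, familyCost_eq hτ, ← tsum_ofReal_tau_succ hτ ht hf,
    Summable.tsum_sum ENNReal.summable ENNReal.summable]
  simp only [Sum.elim_inl, Sum.elim_inr, ht.lsupp]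

/-- `E x = f a * E x * f b` by the bimodule property, and commutativity of `A` brings the two
orthogonal projections together. -/
theorem IsTree.expect_eq_zero (ht : IsTree (subalg M A) G p par f t)
    (h : IsNormalizing (subalg M A) G) (hE : IsCondExp M A E) {a b : ℕ} (hab : a ≠ b) {x : Elt M}
    (h1 : f a * x = x) (h2 : x * f b = x) : E x = 0 := by
  have hEm : E x ∈ subalg M A := hE.map_mem x
  have h3 := hE.bimodule (f a) x (f b) (ht.f_mem a) (ht.f_mem b)
  rw [h1, h2] at h3
  rw [h3, mul_assoc, h.comm _ hEm _ (ht.f_mem b), ← mul_assoc, ht.orth a b hab, zero_mul]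

theorem wordVal_map_inl (v : ι → Elt M) (t : ℕ → Elt M) (w : List (ι × Bool)) :
    wordVal (Sum.elim v t) (w.map fun l => (Sum.inl l.1, l.2)) = wordVal v w := by
  simp only [wordVal, List.map_map]; rfl

theorem root_mul_wordVal (hp : star p = p) (hv : ∀ i, p * v i = v i) (hv' : ∀ i, v i * p = v i)
    {w : List (ι × Bool)} (hw : w ≠ []) : p * wordVal v w = wordVal v w := by
  cases w with
  | nil => exact absurd rfl hw
  | cons l w =>
    rw [wordVal_cons, ← mul_assoc]
    congr 1
    split_ifs
    · exact hv _
    · simpa [hp] using congrArg star (hv' l.1)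

theorem wordVal_mul_root (hp : star p = p) (hv : ∀ i, p * v i = v i) (hv' : ∀ i, v i * p = v i)
    {w : List (ι × Bool)} (hw : w ≠ []) : wordVal v w * p = wordVal v w := by
  have h1 := root_mul_wordVal hp hv hv' (w := FreeGroup.invRev w) (by
    intro h0
    apply hw
    simpa [FreeGroup.invRev] using h0)
  rw [← star_wordVal] at h1
  simpa [hp] using congrArg star h1

/-- By `wordVal_elim_cases` a reduced word is zero or of the form `t n * w * star (t m)` with either
end possibly absent. Distinct end vertices make it off-diagonal; equal ends reduce it to the corner
word `w`. -/
theorem IsTreeing.elim (h : IsNormalizing (subalg M A) G) (hE : IsCondExp M A E)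
    (hG : IsGroupoid M A E G) (ht : IsTree (subalg M A) G p (fun _ => 0) f t)
    (hp : p ∈ projections M A) (hv : ∀ i, v i ∈ corner p G) (hvt : IsTreeing E v) :
    IsTreeing E (Sum.elim v t) := by
  have hl : ∀ i, p * v i = v i := fun i => (mul_of_mem_corner hp.2 (hv i)).1
  have hr : ∀ i, v i * p = v i := fun i => (mul_of_mem_corner hp.2 (hv i)).2
  have htp : ∀ n, t n * p = t n := fun n => by rw [← ht.root]; exact ht.mul_par n
  have hft := fun n => ht.f_mul_t h n
  have hpt : ∀ n, p * t n = 0 := fun n => by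
    rw [← hft, ← mul_assoc, ← ht.root, ht.orth 0 (n + 1) (by omega), zero_mul]
  have hst : ∀ n, star (t n) * f (n + 1) = star (t n) := fun n => by
    simpa [(ht.f_proj (n + 1)).isSelfAdjoint.star_eq] using congrArg star (hft n)
  have hps := ht.star_root
  have hpst : ∀ n, p * star (t n) = star (t n) := fun n => by
    simpa [hps] using congrArg star (htp n)
  intro x hx hred
  rcases wordVal_elim_cases (v := v) (t := t)
    (fun m n => by rw [← htp, mul_assoc, hpt, mul_zero])
    (fun m n hmn => by
      rw [← hst, ← hft n, mul_assoc, ← mul_assoc (f (m + 1)), ht.orth _ _ (by omega)]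
      simp)
    (fun i n => by rw [← hr, mul_assoc, hpt, mul_zero])
    (fun i n => by
      rw [← hl, star_mul, hps, mul_assoc, hpt, mul_zero])
    x hred with h0 | ⟨w, s, e, hwr, hs, he, rfl⟩
  · rw [h0, map_zero]
  rw [wordVal_append, wordVal_append, wordVal_map_inl]
  by_cases hw : w = []
  · subst hw
    rcases hs with rfl | ⟨n, rfl⟩ <;> rcases he with rfl | ⟨m, rfl⟩
    · exact absurd rfl hx
    · simp only [List.map_nil, List.map_cons, wordVal_nil, wordVal_singleton, one_mul]
      exact ht.expect_eq_zero h hE (a := 0) (b := m + 1) (by omega)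
        (by rw [ht.root]; exact hpst m) (hst m)
    · simp only [List.map_nil, List.map_cons, wordVal_nil, wordVal_singleton, mul_one]
      exact ht.expect_eq_zero h hE (a := n + 1) (b := 0) (by omega)
        (hft n) (by rw [ht.root]; exact htp n)
    · have hnm : n ≠ m := by
        rintro rfl
        have := (FreeGroup.isReduced_cons_cons.1 hred).1
        simp at this
      simp only [List.map_nil, List.map_cons, wordVal_nil, wordVal_singleton, one_mul]
      refine ht.expect_eq_zero h hE (a := n + 1) (b := m + 1) (by omega) ?_ ?_
      · rw [← mul_assoc]; exact congrArg (· * _) (hft n)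
      · rw [mul_assoc]; exact congrArg (_ * ·) (hst m)
  have hpw := root_mul_wordVal hps hl hr hw
  have hwp := wordVal_mul_root hps hl hr hw
  rcases hs with rfl | ⟨n, rfl⟩ <;> rcases he with rfl | ⟨m, rfl⟩
  · simp only [List.map_nil, wordVal_nil, one_mul, mul_one]
    exact hvt w hw hwr
  · simp only [List.map_nil, List.map_cons, wordVal_nil, wordVal_singleton, one_mul]
    refine ht.expect_eq_zero h hE (a := 0) (b := m + 1) (by omega) ?_ ?_
    · rw [ht.root, ← mul_assoc, hpw]
    · rw [mul_assoc]; exact congrArg (_ * ·) (hst m)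
  · simp only [List.map_nil, List.map_cons, wordVal_nil, wordVal_singleton, mul_one]
    refine ht.expect_eq_zero h hE (a := n + 1) (b := 0) (by omega) ?_ ?_
    · rw [← mul_assoc]; exact congrArg (· * _) (hft n)
    · rw [ht.root, mul_assoc, hwp]
  · simp only [List.map_nil, List.map_cons, wordVal_singleton]
    -- Equal ends are allowed when the middle word is nonempty; here equivariance of `E` under
    -- conjugation by `t n` is used.
    by_cases hnm : n = m
    · subst hnm
      have := hG.expect_conj _ (ht.t_mem n) (wordVal v w)
      rw [hvt w hw hwr] at this
      simpa [mul_assoc] using this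
    · refine ht.expect_eq_zero h hE (a := n + 1) (b := m + 1) (by omega) ?_ ?_
      · rw [← mul_assoc]; exact congrArg (· * _) (hft n)
      · rw [mul_assoc, mul_assoc]; exact congrArg (_ * ·) (congrArg (_ * ·) (hst m))

end Extend

section Compress

variable {u : ι → Elt M} {l : ℕ → ι × Bool}

/-- The position of the tree element `t n` among the pieces `f a * u i * f b`. -/
def treeIndex (par : ℕ → ℕ) (l : ℕ → ι × Bool) (n : ℕ) : ι × ℕ × ℕ :=
  if (l n).2 then ((l n).1, n + 1, par n) else ((l n).1, par n, n + 1)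

/-- The larger vertex of the edge is `n + 1`, which determines `n`. Thus no piece is counted twice
as a tree edge. -/
theorem treeIndex_injective (hpar : ∀ n, par n ≤ n) : Function.Injective (treeIndex par l) := by
  have key : ∀ n, max (treeIndex par l n).2.1 (treeIndex par l n).2.2 = n + 1 := by
    intro n
    have := hpar n
    unfold treeIndex
    split_ifs
    · exact max_eq_left (this.trans (Nat.le_succ n))
    · exact max_eq_right (this.trans (Nat.le_succ n))
  intro m n hmn
  have h1 := key m
  rw [hmn, key n] at h1
  omega

/-- The pieces `f a * u i * f b` of a family `u`. -/
noncomputable def piece (f : ℕ → Elt M) (u : ι → Elt M) (k : ι × ℕ × ℕ) : Elt M :=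
  f k.2.1 * u k.1 * f k.2.2

/-- The pieces of `u` transported to the corner along the paths `w`. -/
noncomputable def transport (w : ℕ → Elt M) (u : ι → Elt M) (k : ι × ℕ × ℕ) : Elt M :=
  star (w k.2.1) * u k.1 * w k.2.2

/-- The elements `t n` of the tree are pieces of the family `u`. -/
def IsCutFrom (par : ℕ → ℕ) (f t : ℕ → Elt M) (u : ι → Elt M) (l : ℕ → ι × Bool) : Prop :=
  ∀ n, t n = f (n + 1) * (if (l n).2 then u (l n).1 else star (u (l n).1)) * f (par n)

theorem IsCutFrom.eq_wordVal (hl : IsCutFrom par f t u l) (ht : IsTree (subalg M A) G p par f t)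
    (n : ℕ) : t n = wordVal (piece f u) [(treeIndex par l n, (l n).2)] := by
  have hst : ∀ n, star (f n) = f n := fun n => (ht.f_proj n).isSelfAdjoint
  rw [wordVal_singleton, hl n, treeIndex]
  cases hb : (l n).2 <;> simp [piece, hst, mul_assoc]

theorem transport_eq (ht : IsTree (subalg M A) G p par f t) (h : IsNormalizing (subalg M A) G)
    (hw : IsPath p par t w) (k : ι × ℕ × ℕ) :
    transport w u k = star (w k.2.1) * piece f u k * w k.2.2 := by
  rw [transport, piece, ← ht.star_path_mul h hw, ← ht.mul_path h hw k.2.2]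
  have h1 := (ht.f_proj k.2.1).isIdempotentElem.eq
  have h2 := (ht.f_proj k.2.2).isIdempotentElem.eq
  calc star (w k.2.1) * f k.2.1 * u k.1 * (f k.2.2 * w k.2.2)
      = star (w k.2.1) * (f k.2.1 * f k.2.1) * u k.1 * ((f k.2.2 * f k.2.2) * w k.2.2) := by
        rw [h1, h2]
    _ = star (w k.2.1) * f k.2.1 * (f k.2.1 * u k.1 * f k.2.2) * (f k.2.2 * w k.2.2) := by
        simp only [mul_assoc]

/-- By traciality the paths occur only through `w a * star (w a) = f a` and `w b * star (w b) = f
b`. -/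
theorem tau_transport (hτ : IsFaithfulTracialState τ) (ht : IsTree (subalg M A) G p par f t)
    (hw : IsPath p par t w) (k : ι × ℕ × ℕ) :
    τ (transport w u k * star (transport w u k)) = τ (piece f u k * star (piece f u k)) := by
  obtain ⟨i, a, b⟩ := k
  have hst : ∀ n, star (f n) = f n := fun n => (ht.f_proj n).isSelfAdjoint
  have hff : ∀ n, f n * f n = f n := fun n => (ht.f_proj n).isIdempotentElem
  simp only [transport, piece, star_mul, star_star, hst]
  calc τ (star (w a) * u i * w b * (star (w b) * (star (u i) * w a)))
      = τ (star (w a) * (u i * (w b * star (w b)) * star (u i) * w a)) := by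
        simp only [mul_assoc]
    _ = τ (u i * f b * star (u i) * f a) := by
        rw [hτ.tracial, ht.path_mul_star hw, mul_assoc _ (w a), ht.path_mul_star hw]
    _ = τ (u i * (f b * f b) * star (u i) * (f a * f a)) := by rw [hff, hff]
    _ = τ (u i * (f b * f b) * star (u i) * f a * f a) := by rw [mul_assoc _ (f a) (f a)]
    _ = τ (f a * u i * f b * (f b * (star (u i) * f a))) := by
        rw [hτ.tracial]; simp only [mul_assoc]

/-- Normality of `τ` and completeness of `f` allow summation over the source cuts, then over the
range cuts; all terms are nonnegative. -/
theorem tsum_piece (hτ : IsFaithfulTracialState τ) (ht : IsTree (subalg M A) G p par f t)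
    (hf : IsComplete f) :
    ∑' k, ENNReal.ofReal (τ (piece f u k * star (piece f u k))).re = familyCost τ u := by
  have hst : ∀ n, star (f n) = f n := fun n => (ht.f_proj n).isSelfAdjoint
  have hff : ∀ n, f n * f n = f n := fun n => (ht.f_proj n).isIdempotentElem
  rw [familyCost_eq hτ, ENNReal.tsum_prod']
  refine tsum_congr fun i => ?_
  rw [ENNReal.tsum_prod']
  have h1 : ∀ a b, τ (piece f u (i, a, b) * star (piece f u (i, a, b))) =
      τ (f b * (star (u i) * f a * u i)) := by
    intro a b
    simp only [piece, star_mul, hst]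
    calc τ (f a * u i * f b * (f b * (star (u i) * f a)))
        = τ (f a * u i * (f b * f b) * star (u i) * f a) := by simp only [mul_assoc]
      _ = τ ((f a * f a) * u i * f b * star (u i)) := by
        rw [hτ.tracial, hff]; simp only [mul_assoc]
      _ = τ (f a * u i * (f b * star (u i))) := by rw [hff]; simp only [mul_assoc]
      _ = _ := by rw [hτ.tracial]; simp only [mul_assoc]
  have h2 : ∀ a, τ (star (u i) * f a * u i) = τ (f a * (u i * star (u i))) := by
    intro a
    rw [mul_assoc, hτ.tracial, mul_assoc]
  have h3 : ∀ a b, 0 ≤ (τ (f b * (star (u i) * f a * u i))).re := by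
    intro a b
    rw [← h1]
    simpa using hτ.nonneg_re (star (piece f u (i, a, b)))
  calc ∑' a, ∑' b, ENNReal.ofReal (τ (piece f u (i, a, b) * star (piece f u (i, a, b)))).re
      = ∑' a, ENNReal.ofReal (τ (f a * (u i * star (u i)))).re := by
        refine tsum_congr fun a => ?_
        simp only [h1]
        rw [tsum_ofReal_tau hτ ht hf (h3 a), h2]
    _ = _ := by
        refine tsum_ofReal_tau hτ ht hf fun a => ?_
        rw [← h2]
        have := hτ.nonneg_re (f a * u i)
        rw [star_mul, hst] at this
        have h4 : star (u i) * f a * (f a * u i) = star (u i) * f a * u i := by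
          rw [mul_assoc, ← mul_assoc (f a), hff, mul_assoc]
        rwa [h4] at this

/-- The sum over all pieces splits into tree edges, which contribute `1 - τ p`, and the rest, whose
mass is unchanged by transport. -/
theorem familyCost_compress (hτ : IsFaithfulTracialState τ)
    (ht : IsTree (subalg M A) G p par f t) (hf : IsComplete f) (hw : IsPath p par t w)
    (hl : IsCutFrom par f t u l) :
    familyCost τ (fun k : ↥(Set.range (treeIndex par l))ᶜ => transport w u k) +
      ENNReal.ofReal (1 - (τ p).re) = familyCost τ u := by
  rw [← tsum_piece hτ ht hf (u := u), familyCost_eq hτ, ← tsum_ofReal_tau_succ hτ ht hf,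
    ← Summable.tsum_add_tsum_compl (s := Set.range (treeIndex par l)) ENNReal.summable
      ENNReal.summable, add_comm]
  congr 1
  · rw [tsum_range (fun k => ENNReal.ofReal (τ (piece f u k * star (piece f u k))).re)
      (treeIndex_injective ht.par_le)]
    refine tsum_congr fun n => ?_
    rw [← ht.lsupp n, hl.eq_wordVal ht n, wordVal_singleton]
    split_ifs
    · rfl
    · rw [star_star, hτ.tracial]
  · exact tsum_congr fun k => by rw [tau_transport hτ ht hw]

/-- The pieces of a graphing that are not used in the tree, transported to the corner, form a
graphing of the corner. -/
theorem IsGraphing.compress (h : IsNormalizing (subalg M A) G)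
    (ht : IsTree (subalg M A) G p par f t) (hf : IsComplete f) (hw : IsPath p par t w)
    (hl : IsCutFrom par f t u l) (hu : ∀ i, u i ∈ G)
    (hgenG : ∀ T : H →L[ℂ] H, Centralizes T G → ∀ x : Elt M, T * (x : H →L[ℂ] H) = x * T)
    (hgen : ∀ T : H →L[ℂ] H, Centralizes T (subalg M A) → Centralizes T (Set.range u) →
      ∀ x : Elt M, T * (x : H →L[ℂ] H) = x * T) :
    IsGraphing p (corner p (subalg M A)) (corner p G)
      (fun k : ↥(Set.range (treeIndex par l))ᶜ => transport w u k) := by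
  have hwG := ht.path_mem h hw
  have hcG : ∀ y ∈ G, ∀ a b, star (w a) * y * w b ∈ corner p G := fun y hy a b =>
    mem_corner (h.g_mul _ (h.g_mul _ (h.g_star _ (hwG a)) _ hy) _ (hwG b))
      (ht.transport_mul hw a b y).1 (ht.transport_mul hw a b y).2
  refine isGraphing_of_centralizes (fun k => hcG _ (hu _) _ _) ?_ ?_
  · intro T hT hTp
    have hc := ht.commute_corner h hf hw (S := G) hTp
      (fun y hy a b => (hT _ (hcG y hy a b)).1)
      fun T' hT' => hgenG T' fun y hy => ⟨hT' y hy, hT' _ (h.g_star y hy)⟩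
    rintro _ ⟨a, _, rfl⟩
    refine ⟨hc a, ?_⟩
    have : star (p * a * p) = p * star a * p := by
      simp only [star_mul, ht.star_root, mul_assoc]
    simp only [this]
    exact hc _
  · intro T hA hV hTp
    have hdiag : ∀ y ∈ subalg M A, ∀ a, star (w a) * y * w a ∈ corner p (subalg M A) :=
      fun y hy a => mem_corner
        (by simpa using h.conj_mem _ (h.g_star _ (hwG a)) y hy)
        (ht.transport_mul hw a a y).1 (ht.transport_mul hw a a y).2
    have hTA : ∀ y ∈ subalg M A, ∀ a b, T * ((star (w a) * y * w b : Elt M) : H →L[ℂ] H) =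
        ((star (w a) * y * w b : Elt M) : H →L[ℂ] H) * T := by
      intro y hy a b
      by_cases hab : a = b
      · subst hab; exact (hA _ (hdiag y hy a)).1
      · have : star (w a) * y * w b = 0 := by
          rw [← ht.star_path_mul h hw, ← ht.mul_path h hw b, mul_assoc (star (w a)),
            h.comm _ (ht.f_mem a) _ hy]
          calc star (w a) * (y * f a) * (f b * w b) = star (w a) * y * (f a * f b) * w b := by
                simp only [mul_assoc]
            _ = 0 := by rw [ht.orth a b hab]; simp
        rw [this]
        change T * 0 = 0 * T
        simp
    have hTu : ∀ k, T * ((transport w u k : Elt M) : H →L[ℂ] H) = transport w u k * T ∧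
        T * ((star (transport w u k) : Elt M) : H →L[ℂ] H) =
          ((star (transport w u k) : Elt M) : H →L[ℂ] H) * T := by
      intro k
      by_cases hk : k ∈ Set.range (treeIndex par l)
      · obtain ⟨n, rfl⟩ := hk
        -- Transporting a tree edge closes the loop to `star (w (n + 1)) * w (n + 1)`, a projection
        -- of the corner of `A`, so discarding it loses nothing.
        have h1 : star (w (n + 1)) * t n * w (par n) ∈ corner p (subalg M A) := by
          rw [mul_assoc, ← hw.succ]
          have := hdiag 1 h.one_mem (n + 1)
          rwa [mul_one] at this
        have h2 : transport w u (treeIndex par l n) = star (w (n + 1)) * t n * w (par n) ∨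
            transport w u (treeIndex par l n) = star (star (w (n + 1)) * t n * w (par n)) := by
          rw [transport_eq ht h hw, hl.eq_wordVal ht n, wordVal_singleton, treeIndex]
          cases (l n).2
          · right; simp [mul_assoc]
          · left; simp
        have h3 := hA _ h1
        rcases h2 with h2 | h2
        · rw [h2]; exact h3
        · rw [h2, star_star]; exact ⟨h3.2, h3.1⟩
      · exact hV _ ⟨⟨k, hk⟩, rfl⟩
    have hc := ht.commute_corner h hf hw
      (S := subalg M A ∪ Set.range u ∪ star (Set.range u)) hTp (by
        rintro y ((hy | ⟨i, rfl⟩) | ⟨i, hi⟩) a b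
        · exact hTA y hy a b
        · exact (hTu (i, a, b)).1
        · have h1 := (hTu (i, b, a)).2
          have h2 : star (transport w u (i, b, a)) = star (w a) * y * w b := by
            simp only [transport, star_mul, star_star, hi, mul_assoc]
          rwa [h2] at h1)
      fun T' hT' => hgen T'
        (fun y hy => ⟨hT' y (Or.inl (Or.inl hy)), hT' _ (Or.inl (Or.inl (h.star_mem y hy)))⟩)
        (by
          rintro _ ⟨i, rfl⟩
          exact ⟨hT' _ (Or.inl (Or.inr ⟨i, rfl⟩)), hT' _ (Or.inr ⟨i, (star_star _).symm⟩)⟩)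
    rintro _ ⟨a, _, rfl⟩
    refine ⟨hc a, ?_⟩
    have : star (p * a * p) = p * star a * p := by
      simp only [star_mul, ht.star_root, mul_assoc]
    simp only [this]
    exact hc _

theorem piece_mem (ht : IsTree (subalg M A) G p par f t) (h : IsNormalizing (subalg M A) G)
    (hu : ∀ i, u i ∈ G) (k : ι × ℕ × ℕ) : piece f u k ∈ G :=
  h.g_mul _ (h.g_mul _ (h.proj_mem _ (ht.f_mem _) (ht.f_proj _)) _ (hu _)) _
    (h.proj_mem _ (ht.f_mem _) (ht.f_proj _))

/-- The pieces of a treeing that are not used in the tree, transported to the corner, form a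
treeing. -/
theorem IsTreeing.compress (h : IsNormalizing (subalg M A) G) (hE : IsCondExp M A E)
    (ht : IsTree (subalg M A) G p par f t) (hw : IsPath p par t w)
    (hl : IsCutFrom par f t u l) (hu : ∀ i, u i ∈ G) (hut : IsTreeing E u) :
    IsTreeing E (fun k : ↥(Set.range (treeIndex par l))ᶜ => transport w u k) := by
  classical
  have hEl : ∀ a ∈ subalg M A, ∀ x, E (a * x) = a * E x := fun a ha x => by
    simpa using hE.bimodule a x 1 ha h.one_mem
  have hP : ∀ k, piece f u k ∈ G := piece_mem ht h hu
  have hPt : IsTreeing E (piece f u) := hut.cut h hEl hu ht.f_mem ht.f_proj ht.orth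
  -- The retraction that contracts the tree: its edges go to `1`, the remaining pieces to free
  -- generators.
  let κ : ι × ℕ × ℕ → FreeGroup ↥(Set.range (treeIndex par l))ᶜ := fun k =>
    if hk : k ∈ (Set.range (treeIndex par l))ᶜ then FreeGroup.of ⟨k, hk⟩ else 1
  -- Every path is, up to `A`, a word in tree edges only, hence invisible to `κ`.
  have hω : ∀ n, ∃ ω : List ((ι × ℕ × ℕ) × Bool),
      IsMultiple (subalg M A) (piece f u) (w n) ω ∧ FreeGroup.lift κ (FreeGroup.mk ω) = 1 := by
    refine ht.induction ⟨[], ?_, by rw [← FreeGroup.one_eq_mk, map_one]⟩ ?_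
    · rw [hw.zero, ← ht.root]; exact IsMultiple.of_mem (ht.f_mem 0) _
    · rintro n ⟨ω, h1, h2⟩
      refine ⟨[(treeIndex par l n, (l n).2)] ++ ω, ?_, ?_⟩
      · rw [hw.succ]
        refine IsMultiple.mul h hP ?_ h1
        have := IsMultiple.refl h (piece f u) [(treeIndex par l n, (l n).2)]
        rwa [← hl.eq_wordVal ht n] at this
      · rw [← FreeGroup.mul_mk, map_mul, h2, mul_one, FreeGroup.lift_mk]
        have : κ (treeIndex par l n) = 1 := dif_neg fun h => h ⟨n, rfl⟩
        cases (l n).2 <;> simp [this]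
  choose ω hω1 hω2 using hω
  refine hPt.of_expand h hEl hP
    (φ := fun k => FreeGroup.invRev (ω k.1.2.1) ++ [(k.1, true)] ++ ω k.1.2.2) ?_ ?_
  · intro k
    rw [transport_eq ht h hw]
    refine (((hω1 _).star h hP).mul h hP ?_).mul h hP (hω1 _)
    have := IsMultiple.refl h (piece f u) [(k.1, true)]
    rwa [wordVal_singleton, if_pos rfl] at this
  · have hid : (FreeGroup.lift κ).comp (FreeGroup.lift
        fun k : ↥(Set.range (treeIndex par l))ᶜ =>
          FreeGroup.mk (FreeGroup.invRev (ω k.1.2.1) ++ [(k.1, true)] ++ ω k.1.2.2)) =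
        MonoidHom.id _ := by
      refine FreeGroup.ext_hom _ _ fun k => ?_
      have hk : κ k.1 = FreeGroup.of k := dif_pos k.2
      rw [MonoidHom.comp_apply, FreeGroup.lift_apply_of, ← FreeGroup.mul_mk, ← FreeGroup.mul_mk,
        ← FreeGroup.inv_mk, map_mul, map_mul, map_inv, hω2, hω2, FreeGroup.lift_mk]
      simp [hk]
    exact Function.LeftInverse.injective (g := FreeGroup.lift κ) fun x => DFunLike.congr_fun hid x

end Compress

end VNGroupoid

/-! ### Passage between graphings, and the cost identity. -/

namespace VNGroupoid

variable {H : Type*} [NormedAddCommGroup H] [InnerProductSpace ℂ H] [CompleteSpace H]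
  {M A : VonNeumannAlgebra H} {G : Set (Elt M)} {p : Elt M}
  {τ : Elt M →ₗ[ℂ] ℂ} {E : Elt M →ₗ[ℂ] Elt M} {ι : Type}

theorem commute_of_generated (hGM : generated 1 G = (M : Set (H →L[ℂ] H))) {T : H →L[ℂ] H}
    (hT : Centralizes T G) (x : Elt M) : T * (x : H →L[ℂ] H) = x * T := by
  have hx : (x : H →L[ℂ] H) ∈ generated 1 G := by rw [hGM]; exact x.2
  exact Set.mem_centralizer_iff.1 hx.2.2 T
    (mem_centralizer_iff_centralizes.2 ⟨hT, (mul_one T).trans (one_mul T).symm⟩)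

theorem IsGraphing.commute_of_generated (h : IsNormalizing (subalg M A) G)
    (hGM : generated 1 G = (M : Set (H →L[ℂ] H))) {u : ι → Elt M}
    (hu : IsGraphing 1 (subalg M A) G u) {T : H →L[ℂ] H} (hA : Centralizes T (subalg M A))
    (hT : Centralizes T (Set.range u)) (x : Elt M) : T * (x : H →L[ℂ] H) = x * T := by
  have hG : ∀ y ∈ G, T * (y : H →L[ℂ] H) = y * T := fun y hy =>
    hu.commute hA hT ((mul_one T).trans (one_mul T).symm) hy (one_mul y) (mul_one y)
  exact VNGroupoid.commute_of_generated hGM (fun y hy => ⟨hG y hy, hG _ (h.g_star y hy)⟩) x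

/-- An empty graphing may be replaced by one consisting of the element `0`. -/
theorem IsGraphing.of_isEmpty [IsEmpty ι] (h : IsNormalizing (subalg M A) G)
    (hGM : generated 1 G = (M : Set (H →L[ℂ] H))) {u : ι → Elt M}
    (hu : IsGraphing 1 (subalg M A) G u) :
    IsGraphing 1 (subalg M A) G (fun _ : Unit => (0 : Elt M)) := by
  refine isGraphing_of_centralizes (fun _ => h.proj_mem 0 h.zero_mem (.zero _))
    (fun T hT _ y _ => ⟨VNGroupoid.commute_of_generated hGM hT _,
      VNGroupoid.commute_of_generated hGM hT _⟩) (fun T hA _ _ y _ => ?_)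
  have hT : Centralizes T (Set.range u) := by
    rintro _ ⟨i, rfl⟩
    exact isEmptyElim i
  exact ⟨hu.commute_of_generated h hGM hA hT _, hu.commute_of_generated h hGM hA hT _⟩

/-- From a graphing of a groupoid to a graphing of its corner. -/
theorem exists_graphing_corner (h : IsNormalizing (subalg M A) G) (hE : IsCondExp M A E)
    (hτ : IsFaithfulTracialState τ) (hGM : generated 1 G = (M : Set (H →L[ℂ] H)))
    (hp : p ∈ projections M A) (hpc : IsCentralSupport p 1) [Countable ι] {u : ι → Elt M}
    (hu : IsGraphing 1 (subalg M A) G u) :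
    ∃ (κ : Type) (_ : Countable κ) (v : κ → Elt M),
      IsGraphing p (corner p (subalg M A)) (corner p G) v ∧
      familyCost τ v + ENNReal.ofReal (1 - (τ p).re) = familyCost τ u ∧
      (IsTreeing E u → IsTreeing E v) := by
  have main : ∀ {ι : Type} [Countable ι] [Nonempty ι] {u : ι → Elt M},
      IsGraphing 1 (subalg M A) G u → ∃ (κ : Type) (_ : Countable κ) (v : κ → Elt M),
      IsGraphing p (corner p (subalg M A)) (corner p G) v ∧
      familyCost τ v + ENNReal.ofReal (1 - (τ p).re) = familyCost τ u ∧
      (IsTreeing E u → IsTreeing E v) := by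
    intro ι _ _ u hu
    have hgen : ∀ T : H →L[ℂ] H, Centralizes T (subalg M A) → Centralizes T (Set.range u) →
        ∀ x : Elt M, T * (x : H →L[ℂ] H) = x * T :=
      fun T hA hT => hu.commute_of_generated h hGM hA hT
    obtain ⟨par, f, t, l, ht, hf, hl⟩ := exists_complete_tree h hu.1 hgen hp hpc
    obtain ⟨w, hw⟩ := ht.exists_isPath
    exact ⟨_, inferInstance, _, IsGraphing.compress h ht hf hw hl hu.1
      (fun T hT => commute_of_generated hGM hT) hgen, familyCost_compress hτ ht hf hw hl,
      fun hut => hut.compress h hE ht hw hl hu.1⟩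
  rcases isEmpty_or_nonempty ι with hι | hι
  -- Enumerating letters requires a nonempty index type. The one-member family `0` also costs
  -- nothing, and it is a treeing because every nonempty word in it vanishes.
  · obtain ⟨κ, hκ, v, h1, h2, h3⟩ := main (hu.of_isEmpty h hGM)
    refine ⟨κ, hκ, v, h1, h2.trans ?_, fun _ => h3 fun w hw _ => ?_⟩
    · simp [familyCost, lsupp, rsupp]
    · cases w with
      | nil => exact absurd rfl hw
      | cons l w => rw [wordVal_cons]; simp
  · exact main hu

/-- From a graphing of the corner of a groupoid to a graphing of the groupoid. -/
theorem exists_graphing_of_corner (h : IsNormalizing (subalg M A) G) (hE : IsCondExp M A E)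
    (hG : IsGroupoid M A E G)
    (hτ : IsFaithfulTracialState τ) (hGM : generated 1 G = (M : Set (H →L[ℂ] H)))
    (hp : p ∈ projections M A) (hpc : IsCentralSupport p 1) [Countable ι] {v : ι → Elt M}
    (hv : IsGraphing p (corner p (subalg M A)) (corner p G) v) :
    ∃ (κ : Type) (_ : Countable κ) (u : κ → Elt M), IsGraphing 1 (subalg M A) G u ∧
      familyCost τ u = familyCost τ v + ENNReal.ofReal (1 - (τ p).re) ∧
      (IsTreeing E v → IsTreeing E u) := by
  have hgen : ∀ T : H →L[ℂ] H, Centralizes T G → ∀ x : Elt M, T * (x : H →L[ℂ] H) = x * T :=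
    fun T hT => commute_of_generated hGM hT
  obtain ⟨f, t, ht, hf⟩ := exists_complete_star h hτ hgen hp hpc
  exact ⟨_, inferInstance, _, hv.elim h ht hf hgen hp, familyCost_elim hτ ht hf,
    fun hvt => hvt.elim h hE hG ht hp hv.1⟩

/-- Stated additively, so that infinite costs need no separate treatment; each inequality is one of
the two passages between graphings. -/
theorem cost_eq_cost_corner_add (h : IsNormalizing (subalg M A) G) (hE : IsCondExp M A E)
    (hG : IsGroupoid M A E G)
    (hτ : IsFaithfulTracialState τ) (hGM : generated 1 G = (M : Set (H →L[ℂ] H)))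
    (hp : p ∈ projections M A) (hpc : IsCentralSupport p 1) :
    cost τ 1 (subalg M A) G =
      cost τ p (corner p (subalg M A)) (corner p G) + ENNReal.ofReal (1 - (τ p).re) := by
  refine le_antisymm ?_ (le_sInf ?_)
  · rw [cost, cost, ENNReal.sInf_add]
    refine le_iInf₂ ?_
    rintro _ ⟨ι, _, v, hv, rfl⟩
    obtain ⟨κ, hκ, u, hu, hc, _⟩ := exists_graphing_of_corner h hE hG hτ hGM hp hpc hv
    exact sInf_le ⟨κ, hκ, u, hu, hc.symm⟩
  · rintro _ ⟨ι, _, u, hu, rfl⟩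
    obtain ⟨κ, hκ, v, hv, hc, _⟩ := exists_graphing_corner h hE hτ hGM hp hpc hu
    rw [← hc]
    exact add_le_add (sInf_le ⟨κ, hκ, v, hv, rfl⟩) le_rfl

theorem coe_sub_one_eq {a b : ℝ≥0∞} {r : ℝ} (hr : r ≤ 1)
    (hab : a = b + ENNReal.ofReal (1 - r)) : (a : EReal) - 1 = (b : EReal) - (r : EReal) := by
  subst hab
  rw [EReal.coe_ennreal_add, EReal.coe_ennreal_ofReal, max_eq_left (by linarith)]
  -- When the corner cost is infinite both sides are `⊤`, since only finite numbers are subtracted.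
  induction b using ENNReal.recTopCoe with
  | top =>
    rw [EReal.coe_ennreal_top, EReal.top_add_coe, EReal.top_sub_coe]
    exact EReal.top_sub_coe 1
  | coe b =>
    rw [EReal.coe_nnreal_eq_coe_real, ← EReal.coe_add, ← EReal.coe_one, ← EReal.coe_sub,
      ← EReal.coe_sub]
    congr 1
    ring

end VNGroupoid

theorem mainTheorem6 {H : Type*} [NormedAddCommGroup H] [InnerProductSpace ℂ H] [CompleteSpace H]
    (M A : VonNeumannAlgebra H) (hAM : A ≤ M)
    (hA : ∀ a ∈ A, ∀ b ∈ A, a * b = b * a)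
    (E : VNGroupoid.Elt M →ₗ[ℂ] VNGroupoid.Elt M) (hE : VNGroupoid.IsCondExp M A E)
    (G : Set (VNGroupoid.Elt M)) (hG : VNGroupoid.IsGroupoid M A E G)
    (hGM : VNGroupoid.generated 1 G = (M : Set (H →L[ℂ] H)))
    (τ : VNGroupoid.Elt M →ₗ[ℂ] ℂ) (hτ : VNGroupoid.IsFaithfulTracialState τ)
    (hτE : ∀ x, τ (E x) = τ x)
    (p : VNGroupoid.Elt M) (hp : p ∈ VNGroupoid.projections M A)
    (hpc : VNGroupoid.IsCentralSupport p 1) :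
    (VNGroupoid.IsTreeable E 1 (VNGroupoid.subalg M A) G ↔
      VNGroupoid.IsTreeable E p (VNGroupoid.corner p (VNGroupoid.subalg M A))
        (VNGroupoid.corner p G)) ∧
    (VNGroupoid.cost τ 1 (VNGroupoid.subalg M A) G : EReal) - 1 =
      (VNGroupoid.cost τ p (VNGroupoid.corner p (VNGroupoid.subalg M A))
        (VNGroupoid.corner p G) : EReal) - ((τ p).re : EReal) := by
  have h := hG.isNormalizing hτ hA
  refine ⟨⟨?_, ?_⟩, ?_⟩
  · rintro ⟨ι, _, u, hu, hut⟩
    obtain ⟨κ, hκ, v, hv, _, ht⟩ := VNGroupoid.exists_graphing_corner h hE hτ hGM hp hpc hu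
    exact ⟨κ, hκ, v, hv, ht hut⟩
  · rintro ⟨ι, _, v, hv, hvt⟩
    obtain ⟨κ, hκ, u, hu, _, ht⟩ := VNGroupoid.exists_graphing_of_corner h hE hG hτ hGM hp hpc hv
    exact ⟨κ, hκ, u, hu, ht hvt⟩
  · exact VNGroupoid.coe_sub_one_eq (VNGroupoid.tau_projection hτ hp.2).2
      (VNGroupoid.cost_eq_cost_corner_add h hE hG hτ hGM hp hpc)
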